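/- Let $N\ge 2$. A state of $N$ qubits is a positive semidefinite operator of trace one on $(\mathbb C^2)^{\otimes N}$. A pure state is biseparable if it is a tensor product of two unit vectors for some partition of the qubits into two nonempty parts; a state is biseparable if it is a convex mixture of pure biseparable states (the partitions may differ from term to term). For a function $D$ with values in $[0,\infty]$ on pairs of states put $E^D_2(\varrho)=\inf\{D(\varrho,\varsigma):\varsigma \text{ biseparable}\}$. For a bit string $i$ of length $N$ with leading bit $0$ let $|\beta_i^{\pm}\rangle=\frac1{\sqrt2}\big(\mathbb I^{\otimes N}\pm\sigma_1^{\otimes N}\big)|i\rangle$, where $\sigma_1$ is the bit flip; these $2^N$ vectors form an orthonormal basis. A state $\xi=\sum_{i,\pm}p_i^\pm|\beta_i^\pm\rangle\langle\beta_i^\pm|$ is called GHZ-diagonal; let $p_{\max}=\max_{i,\pm}p_i^\pm$. Call $D$ valid (on $N$ qubits) if $D(\varrho,\varrho)=0$, if $D(\Omega(\varrho),\Omega(\varrho'))\le D(\varrho,\varrho')$ for all states and all completely positive trace preserving maps $\Omega$, and if $D$ is convex in its second argument. In particular, every contractive jointly convex $D$ with $D(\varrho,\varrho)=0$ is valid.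 (a) A GHZ-diagonal state is biseparable if and only if $p_{\max}\le\frac12$. There is a fixed convex mixture of conjugations by tensor products of single-qubit unitaries that maps every $N$-qubit state $\varrho$ to the GHZ-diagonal state $\Gamma(\varrho)$ with eigenvalues $p_i^\pm=\langle\beta_i^\pm|\varrho|\beta_i^\pm\rangle$ (GHZ-diagonalisation). (b) For every valid $D$ there is a function $g_D:(\frac12,1]\to[0,\infty]$ with the following properties. (i) If a GHZ-diagonal state $\xi$ is not biseparable and $|\beta\rangle$ is a GHZ basis vector belonging to its largest eigenvalue, then some GHZ-diagonal state whose eigenvalue at $|\beta\rangle$ is $\frac12$ is biseparable and attains $\inf_{\varsigma}D(\xi,\varsigma)$ over all biseparable $\varsigma$. (ii) For every GHZ-diagonal $\xi$, $E^D_2(\xi)=0$ if $p_{\max}\le\frac12$, and $E^D_2(\xi)=g_D(p_{\max})$ if $p_{\max}>\frac12$. (iii) $g_D$ is nondecreasing. If moreover $D$ vanishes only on pairs of equal states, then $g_D(p)<g_D(p')$ whenever $\frac12<p<p'\le1$ and $g_D(p)<\infty$. (iv) For every $N$-qubit state $\varrho$ and every tensor product $U$ of single-qubit unitaries, $E^D_2(\varrho)\ge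 E^D_2(\Gamma(U\varrho U^\dagger))$; and if $P=\langle\beta|U\varrho U^\dagger|\beta\rangle>\frac12$ for some GHZ basis vector $|\beta\rangle$, then $E^D_2(\varrho)\ge g_D(P)$. If $D$ is given for all numbers of qubits, is valid for each of them, and is contractive also under the completely positive trace preserving maps that change the number of qubits, then $g_D$ can be chosen independent of $N$. (c) For every $N\ge2$, properties (i)–(iv) hold for the following distances $D$ with the following functions $g_D$, each of which is strictly increasing on $[\frac12,1]$ (with $0\log_2 0=0$): - relative entropy $D_{\rm RE}(\varrho,\varsigma)=\operatorname{Tr}[\varrho(\log_2\varrho-\log_2\varsigma)]$ ($+\infty$ unless $\ker\varsigma\subseteq\ker\varrho$): $g=1+p\log_2p+(1-p)\log_2(1-p)$; - trace distance $D_{\rm Tr}(\varrho,\varsigma)=\frac12\operatorname{Tr}|\varrho-\varsigma|$: $g=p-\frac12$; - infidelity $D_{\rm F}(\varrho,\varsigma)=1-\big[\operatorname{Tr}\sqrt{\sqrt\varsigma\varrho\sqrt\varsigma}\big]^2$: $g=\frac12-\sqrt{p(1-p)}$; - squared Bures distance $D_{\rm B}(\varrho,\varsigma)=2\big[1-\operatorname{Tr}\sqrt{\sqrt\varsigma\varrho\sqrt\varsigma}\big]$: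 $g=2-\sqrt2\,(\sqrt{1-p}+\sqrt p)$; - squared Hellinger distance $D_{\rm H}(\varrho,\varsigma)=2\big[1-\operatorname{Tr}(\sqrt\varrho\sqrt\varsigma)\big]$: $g=2-\sqrt2\,(\sqrt{1-p}+\sqrt p)$. -/

import Mathlib

open scoped ENNReal ComplexOrder

noncomputable section

namespace GHZ

/-! ### States and quantum channels -/

/-- Density matrices: positive semidefinite complex matrices of trace one. -/
def IsState {n : Type*} [Fintype n] (ρ : Matrix n n ℂ) : Prop :=
  ρ.PosSemidef ∧ ρ.trace = 1

/-- The map `id_k ⊗ Φ`, acting blockwise on `k × k` block matrices. -/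
def ampliation {m n : Type*} (Φ : Matrix m m ℂ →ₗ[ℂ] Matrix n n ℂ) (k : ℕ)
    (X : Matrix (Fin k × m) (Fin k × m) ℂ) : Matrix (Fin k × n) (Fin k × n) ℂ :=
  Matrix.of fun a b => Φ (Matrix.of fun i j => X (a.1, i) (b.1, j)) a.2 b.2

/-- Quantum channels: completely positive, trace preserving linear maps. -/
structure IsChannel {m n : Type*} [Fintype m] [Fintype n]
    (Φ : Matrix m m ℂ →ₗ[ℂ] Matrix n n ℂ) : Prop where
  completelyPositive : ∀ (k : ℕ) (X : Matrix (Fin k × m) (Fin k × m) ℂ),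
    X.PosSemidef → (ampliation Φ k X).PosSemidef
  tracePreserving : ∀ X : Matrix m m ℂ, (Φ X).trace = X.trace

/-- The rank-one operator `|ψ⟩⟨ψ|`. -/
def proj {n : Type*} (ψ : n → ℂ) : Matrix n n ℂ := Matrix.vecMulVec ψ (star ψ)

/-! ### Qubits -/

/-- Labels of the computational basis of `N` qubits. -/
abbrev Bits (N : ℕ) : Type := Fin N → Fin 2

/-- Operators on `N` qubits, in the computational basis. -/
abbrev QOp (N : ℕ) : Type := Matrix (Bits N) (Bits N) ℂ

/-- The tensor product `U₁ ⊗ ⋯ ⊗ U_N` of single-qubit operators. -/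
def localOp {N : ℕ} (U : Fin N → Matrix (Fin 2) (Fin 2) ℂ) : QOp N :=
  Matrix.of fun x y => ∏ k, U k (x k) (y k)

/-- Conjugation `ρ ↦ U ρ U†` by `U = U₁ ⊗ ⋯ ⊗ U_N`. -/
def localConj {N : ℕ} (U : Fin N → Matrix (Fin 2) (Fin 2) ℂ) (ρ : QOp N) : QOp N :=
  localOp U * ρ * (localOp U).conjTranspose

/-- `ψ = ⨂_{k < M} ψ⁽ᵏ⁾` for some partition of the `N` qubits into `M` nonempty parts, the `k`-th
part being the qubits `i` with `part i = k`, and some unit vectors `ψ⁽ᵏ⁾` of the parts. -/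
def IsPureMSeparable (N M : ℕ) (ψ : Bits N → ℂ) : Prop :=
  ∃ part : Fin N → Fin M, Function.Surjective part ∧
    ∃ φ : (k : Fin M) → ({i : Fin N // part i = k} → Fin 2) → ℂ,
      (∀ k, ∑ y, ‖φ k y‖ ^ 2 = 1) ∧
      ∀ x, ψ x = ∏ k, φ k (fun i => x i.1)

/-- The set of `M`-separable states: convex mixtures of pure `M`-separable states, the partition
being allowed to vary from term to term. For `M = 2` these are the biseparable states. -/
def mSeparable (N M : ℕ) : Set (QOp N) :=
  convexHull ℝ {ρ | ∃ ψ, IsPureMSeparable N M ψ ∧ ρ = proj ψ}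

/-- The geometric measure `E^D_M(ρ) = inf {D(ρ, ς) | ς M-separable}`. -/
def entanglement {N : ℕ} (M : ℕ) (D : QOp N → QOp N → ℝ≥0∞) (ρ : QOp N) : ℝ≥0∞ :=
  ⨅ ς ∈ mSeparable N M, D ρ ς

/-! ### GHZ-diagonal states -/

/-- Labels `(i, ±)` of the GHZ basis; `i` runs through the first half of the binary ordered
computational basis, i.e. the bit strings with leading bit `0`. -/
abbrev Index (N : ℕ) : Type := {i : Bits N // ∀ k : Fin N, (k : ℕ) = 0 → i k = 0} × ℤˣ

/-- The GHZ basis vector `|β_i^±⟩ = (|i⟩ ± σ₁^{⊗N}|i⟩) / √2`, where `σ₁^{⊗N}` flips all bits. -/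
def ghzVec {N : ℕ} (b : Index N) : Bits N → ℂ :=
  ((Real.sqrt 2 : ℝ) : ℂ)⁻¹ •
    (Pi.single b.1.1 1 + ((b.2 : ℤ) : ℂ) • Pi.single (fun k => Fin.rev (b.1.1 k)) 1)

/-- The operator `∑ p_i^± |β_i^±⟩⟨β_i^±|`. -/
def ghzDiag {N : ℕ} (p : Index N → ℝ) : QOp N :=
  ∑ b, (p b : ℂ) • proj (ghzVec b)

/-- The overlap `⟨β_i^±|ρ|β_i^±⟩`. -/
def overlap {N : ℕ} (ρ : QOp N) (b : Index N) : ℝ :=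
  (star (ghzVec b) ⬝ᵥ (ρ.mulVec (ghzVec b))).re

/-! ### Distances; only their values on states matter -/

/-- Contractive convex distances on the states of `N` qubits. Convexity is asked only in the second
argument, which is the case `ρ = ρ'` of joint convexity
`D(qρ + (1-q)ρ', qχ + (1-q)χ') ≤ q D(ρ, χ) + (1-q) D(ρ', χ')`. -/
structure IsContractiveConvex {N : ℕ} (D : QOp N → QOp N → ℝ≥0∞) : Prop where
  self : ∀ ρ, IsState ρ → D ρ ρ = 0
  contractive : ∀ Φ : QOp N →ₗ[ℂ] QOp N, IsChannel Φ →
    ∀ ρ σ, IsState ρ → IsState σ → D (Φ ρ) (Φ σ) ≤ D ρ σ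
  convex : ∀ ρ χ χ' : QOp N, IsState ρ → IsState χ → IsState χ' →
    ∀ q : ℝ, 0 ≤ q → q ≤ 1 →
      D ρ (q • χ + (1 - q) • χ') ≤ ENNReal.ofReal q * D ρ χ + ENNReal.ofReal (1 - q) * D ρ χ'

/-- A distance given for all numbers of qubits at once, contractive also under the channels that
change the number of qubits. -/
structure IsContractiveConvexFamily (D : (N : ℕ) → QOp N → QOp N → ℝ≥0∞) : Prop where
  each : ∀ N, IsContractiveConvex (D N)
  contractive : ∀ (N N' : ℕ) (Φ : QOp N →ₗ[ℂ] QOp N'), IsChannel Φ →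
    ∀ ρ σ, IsState ρ → IsState σ → D N' (Φ ρ) (Φ σ) ≤ D N ρ σ

/-- `D` separates states. -/
def IsFaithful {N : ℕ} (D : QOp N → QOp N → ℝ≥0∞) : Prop :=
  ∀ ρ σ, IsState ρ → IsState σ → D ρ σ = 0 → ρ = σ

section Standard

variable {n : Type*} [Fintype n] [DecidableEq n]

/-! The continuous functional calculus `cfc f A` applies `f` to the eigenvalues of the Hermitian
matrix `A`. All five expressions are nonnegative on states. -/

open Classical in
/-- Relative entropy `Tr[ρ (log₂ ρ - log₂ σ)]`, infinite unless the kernel of `σ` lies in that of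
`ρ`; here `log₂ 0 = 0`, which amounts to `0 log₂ 0 = 0`. -/
def dRE (ρ σ : Matrix n n ℂ) : ℝ≥0∞ :=
  if ∀ v : n → ℂ, σ.mulVec v = 0 → ρ.mulVec v = 0 then
    ENNReal.ofReal (ρ * (cfc (Real.logb 2) ρ - cfc (Real.logb 2) σ)).trace.re
  else ⊤

/-- Trace distance `½ Tr|ρ - σ|`. -/
def dTr (ρ σ : Matrix n n ℂ) : ℝ≥0∞ :=
  ENNReal.ofReal (1 / 2 * (cfc (fun x : ℝ => |x|) (ρ - σ)).trace.re)

/-- `Tr √(√σ ρ √σ)`. -/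
def rootFidelity (ρ σ : Matrix n n ℂ) : ℝ :=
  (cfc Real.sqrt (cfc Real.sqrt σ * ρ * cfc Real.sqrt σ)).trace.re

/-- Infidelity `1 - [Tr √(√σ ρ √σ)]²`. -/
def dF (ρ σ : Matrix n n ℂ) : ℝ≥0∞ := ENNReal.ofReal (1 - rootFidelity ρ σ ^ 2)

/-- Squared Bures distance `2 [1 - Tr √(√σ ρ √σ)]`. -/
def dB (ρ σ : Matrix n n ℂ) : ℝ≥0∞ := ENNReal.ofReal (2 * (1 - rootFidelity ρ σ))

/-- Squared Hellinger distance `2 [1 - Tr(√ρ √σ)]`. -/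
def dH (ρ σ : Matrix n n ℂ) : ℝ≥0∞ :=
  ENNReal.ofReal (2 * (1 - (cfc Real.sqrt ρ * cfc Real.sqrt σ).trace.re))

end Standard

/-! ### The explicit functions of the largest eigenvalue -/

def gRE (p : ℝ) : ℝ := 1 + p * Real.logb 2 p + (1 - p) * Real.logb 2 (1 - p)

def gTr (p : ℝ) : ℝ := p - 1 / 2

def gF (p : ℝ) : ℝ := 1 / 2 - Real.sqrt (p * (1 - p))

def gB (p : ℝ) : ℝ := 2 - Real.sqrt 2 * (Real.sqrt (1 - p) + Real.sqrt p)

/-! ### The form of the result for one distance -/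

/-- The genuine entanglement `E^D_2` of `N`-qubit GHZ-diagonal states is governed by the function
`g` of the largest eigenvalue. Here `p` is the list of eigenvalues of the GHZ-diagonal state and
`b₀` the label of a largest one. -/
structure GenuineLaw (N : ℕ) (D : QOp N → QOp N → ℝ≥0∞) (g : ℝ → ℝ≥0∞) : Prop where
  /-- If the state is not biseparable, then one of its closest biseparable states is GHZ-diagonal
  with eigenvalue `1/2` at `b₀`. -/
  closest : ∀ p ∈ stdSimplex ℝ (Index N), ∀ b₀, (∀ b, p b ≤ p b₀) →
    ghzDiag p ∉ mSeparable N 2 →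
    ∃ q ∈ stdSimplex ℝ (Index N), q b₀ = 1 / 2 ∧ ghzDiag q ∈ mSeparable N 2 ∧
      ∀ ς ∈ mSeparable N 2, D (ghzDiag p) (ghzDiag q) ≤ D (ghzDiag p) ς
  eq_zero : ∀ p ∈ stdSimplex ℝ (Index N), ∀ b₀, (∀ b, p b ≤ p b₀) → p b₀ ≤ 1 / 2 →
    entanglement 2 D (ghzDiag p) = 0
  eq_g : ∀ p ∈ stdSimplex ℝ (Index N), ∀ b₀, (∀ b, p b ≤ p b₀) → 1 / 2 < p b₀ →
    entanglement 2 D (ghzDiag p) = g (p b₀)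
  mono : MonotoneOn g (Set.Ioc (1 / 2) 1)
  strictMono : IsFaithful D → ∀ p p' : ℝ, 1 / 2 < p → p < p' → p' ≤ 1 → g p ≠ ⊤ → g p < g p'
  /-- The genuine entanglement of an arbitrary state is at least that of its GHZ-diagonalisation,
  also after local unitaries. -/
  diagonalisation_le : ∀ ρ : QOp N, IsState ρ → ∀ U : Fin N → Matrix (Fin 2) (Fin 2) ℂ,
    (∀ k, U k ∈ Matrix.unitaryGroup (Fin 2) ℂ) →
    entanglement 2 D (ghzDiag (overlap (localConj U ρ))) ≤ entanglement 2 D ρ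
  /-- Lower bound from a single overlap larger than `1/2`. -/
  lower_bound : ∀ ρ : QOp N, IsState ρ → ∀ U : Fin N → Matrix (Fin 2) (Fin 2) ℂ,
    (∀ k, U k ∈ Matrix.unitaryGroup (Fin 2) ℂ) →
    ∀ b, 1 / 2 < overlap (localConj U ρ) b →
      g (overlap (localConj U ρ) b) ≤ entanglement 2 D ρ

end GHZ

end

/-!
A product vector `ψ = φ ⊗ χ` satisfies `|ψ x| + |ψ x̄| ≤ 1`, where `x̄` is the flipped string, so a
biseparable state has overlap at most `1/2` with every GHZ vector. Conversely, the probability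
distributions capped by `1/2` are mixtures of midpoints of two vertices, and the midpoint of two GHZ
projections is also the midpoint of two projections onto product vectors. Averaging over the
conjugations by the diagonal sign matrices and by `σ₁ ⊗ ⋯ ⊗ σ₁` that fix the GHZ projections gives
the GHZ-diagonalisation, which preserves biseparability.

The problem is thereby reduced to two states whose overlaps with one unit vector `β` are `P > 1/2`
and at most `1/2`. For a valid `D`, measuring `{β, 1 - β}` and preparing a fixed GHZ vector or a
fixed state orthogonal to it maps the pair into a two-outcome family, in which the minimum is a
function of `P` alone. A channel that damps the overlap with `β`, combined with convexity in the
second argument, yields the monotonicity of this function.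

For the concrete distances the same lower bound is proved directly. The trace distance and the
fidelities are estimated on `β` and its complement separately, the fidelities by Cauchy-Schwarz with
a partial isometry. For the relative entropy, the Nussbaum–Szkoła distributions express the
derivative along the segment from `σ` to `ρ` through resolvents, and the two-outcome bound for these
is integrated over the segment.
-/

noncomputable section

namespace GHZ

open Matrix

/-! ### Expectation values -/

section Expectation

variable {n : Type*}

lemma proj_smul (c : ℂ) (ψ : n → ℂ) : proj (c • ψ) = (‖c‖ ^ 2 : ℝ) • proj ψ := by
  ext x y
  simp only [proj, vecMulVec_apply, Pi.smul_apply, Pi.star_apply, Matrix.smul_apply, smul_eq_mul,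
    star_mul', Complex.real_smul, Complex.ofReal_pow, ← Complex.mul_conj', Complex.star_def]
  ring

lemma proj_add_add_proj_sub (φ ψ : n → ℂ) :
    proj (φ + ψ) + proj (φ - ψ) = (2 : ℝ) • (proj φ + proj ψ) := by
  ext x y
  simp only [proj, vecMulVec_apply, Pi.star_apply, Matrix.add_apply, Matrix.smul_apply,
    Pi.add_apply, Pi.sub_apply, star_add, star_sub, Complex.real_smul, Complex.ofReal_ofNat]
  ring

lemma posSemidef_proj [Finite n] (ψ : n → ℂ) : (proj ψ).PosSemidef :=
  posSemidef_vecMulVec_self_star ψ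

variable [Fintype n]

/-- The expectation value `⟨ψ|ρ|ψ⟩`, as a real linear function of `ρ`. Only the real part is kept;
nothing is lost when `ρ` is Hermitian. -/
def expVal (ψ : n → ℂ) : Matrix n n ℂ →ₗ[ℝ] ℝ where
  toFun ρ := (star ψ ⬝ᵥ ρ *ᵥ ψ).re
  map_add' ρ σ := by rw [add_mulVec, dotProduct_add, Complex.add_re]
  map_smul' c ρ := by simp [smul_mulVec]

lemma expVal_apply (ψ : n → ℂ) (ρ : Matrix n n ℂ) : expVal ψ ρ = (star ψ ⬝ᵥ ρ *ᵥ ψ).re := rfl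

lemma coe_expVal (ψ : n → ℂ) {ρ : Matrix n n ℂ} (h : ρ.IsHermitian) :
    (expVal ψ ρ : ℂ) = star ψ ⬝ᵥ ρ *ᵥ ψ :=
  Complex.ext rfl (h.im_star_dotProduct_mulVec_self ψ).symm

lemma expVal_nonneg (ψ : n → ℂ) {ρ : Matrix n n ℂ} (h : ρ.PosSemidef) : 0 ≤ expVal ψ ρ :=
  (Complex.le_def.1 (h.dotProduct_mulVec_nonneg ψ)).1

lemma convex_setOf_expVal_le (ψ : n → ℂ) (c : ℝ) :
    Convex ℝ {ρ : Matrix n n ℂ | expVal ψ ρ ≤ c} :=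
  convex_halfSpace_le (expVal ψ).isLinear c

lemma expVal_mul_mul_conjTranspose (A ρ : Matrix n n ℂ) (ψ : n → ℂ) :
    expVal ψ (A * ρ * Aᴴ) = expVal (Aᴴ *ᵥ ψ) ρ := by
  rw [expVal_apply, expVal_apply, star_mulVec, conjTranspose_conjTranspose, ← dotProduct_mulVec,
    mulVec_mulVec, mulVec_mulVec, Matrix.mul_assoc]

lemma trace_proj_mul (ψ : n → ℂ) (ρ : Matrix n n ℂ) :
    (proj ψ * ρ).trace = star ψ ⬝ᵥ ρ *ᵥ ψ := by
  rw [proj, vecMulVec_mul, trace_vecMulVec, dotProduct_comm, ← dotProduct_mulVec]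

lemma trace_proj (ψ : n → ℂ) : (proj ψ).trace = star ψ ⬝ᵥ ψ := by
  rw [proj, trace_vecMulVec, dotProduct_comm]

lemma expVal_eq_re_trace (ψ : n → ℂ) (ρ : Matrix n n ℂ) :
    expVal ψ ρ = (proj ψ * ρ).trace.re := by
  rw [trace_proj_mul, expVal_apply]

lemma expVal_proj (ψ φ : n → ℂ) : expVal ψ (proj φ) = ‖star ψ ⬝ᵥ φ‖ ^ 2 := by
  have hconj : star φ ⬝ᵥ ψ = star (star ψ ⬝ᵥ φ) := by rw [star_dotProduct]
  rw [expVal_apply, proj, vecMulVec_mulVec, op_smul_eq_smul, dotProduct_smul, hconj, smul_eq_mul,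
    Complex.star_def, Complex.conj_mul', ← Complex.ofReal_pow, Complex.ofReal_re]

lemma isStarProjection_proj {ψ : n → ℂ} (h : star ψ ⬝ᵥ ψ = 1) : IsStarProjection (proj ψ) where
  isIdempotentElem := by
    rw [IsIdempotentElem, proj, vecMulVec_mul_vecMulVec, h, one_smul]
  isSelfAdjoint := (posSemidef_proj ψ).isHermitian

lemma isState_proj {ψ : n → ℂ} (h : star ψ ⬝ᵥ ψ = 1) : IsState (proj ψ) :=
  ⟨posSemidef_proj ψ, by rw [trace_proj, h]⟩

lemma mul_proj_mul_conjTranspose (A : Matrix n n ℂ) (ψ : n → ℂ) :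
    A * proj ψ * Aᴴ = proj (A *ᵥ ψ) := by
  rw [proj, proj, mul_vecMulVec, vecMulVec_mul, star_mulVec]

lemma star_dotProduct_self_eq_one_iff (ψ : n → ℂ) :
    star ψ ⬝ᵥ ψ = 1 ↔ ∑ y, ‖ψ y‖ ^ 2 = 1 := by
  have hsum : star ψ ⬝ᵥ ψ = ((∑ y, ‖ψ y‖ ^ 2 : ℝ) : ℂ) := by
    simp [dotProduct, Complex.conj_mul']
  rw [hsum, Complex.ofReal_eq_one]

lemma convex_setOf_isState : Convex ℝ {ρ : Matrix n n ℂ | IsState ρ} := by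
  rintro ρ ⟨hρ, hρ1⟩ σ ⟨hσ, hσ1⟩ a b ha hb hab
  refine ⟨(hρ.smul ha).add (hσ.smul hb), ?_⟩
  rw [trace_add, trace_smul, trace_smul, hρ1, hσ1, ← add_smul, hab, one_smul]

lemma posSemidef_of_isStarProjection {E : Matrix n n ℂ} (hE : IsStarProjection E) :
    E.PosSemidef := by
  have h : Eᴴ * E = E := by
    rw [← star_eq_conjTranspose, hE.isSelfAdjoint.star_eq, hE.isIdempotentElem.eq]
  exact h ▸ posSemidef_conjTranspose_mul_self E

open scoped MatrixOrder in
lemma re_trace_mul_nonneg {A B : Matrix n n ℂ} (hA : A.PosSemidef) (hB : B.PosSemidef) :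
    0 ≤ (A * B).trace.re := by
  classical
  obtain ⟨C, rfl⟩ := CStarAlgebra.nonneg_iff_eq_star_mul_self.1 hB.nonneg
  rw [← Matrix.mul_assoc, trace_mul_comm, ← Matrix.mul_assoc]
  exact (Complex.le_def.1 (hA.mul_mul_conjTranspose_same C).trace_nonneg).1

variable [DecidableEq n]

lemma star_mulVec_dotProduct_mulVec {A : Matrix n n ℂ} (hA : Aᴴ * A = 1) (ψ : n → ℂ) :
    star (A *ᵥ ψ) ⬝ᵥ A *ᵥ ψ = star ψ ⬝ᵥ ψ := by
  rw [star_mulVec, ← dotProduct_mulVec, mulVec_mulVec, hA, one_mulVec]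

lemma posSemidef_one_sub_proj {ψ : n → ℂ} (hψ : star ψ ⬝ᵥ ψ = 1) :
    (1 - proj ψ).PosSemidef :=
  posSemidef_of_isStarProjection (isStarProjection_proj hψ).one_sub

lemma re_trace_one_sub_proj_mul (ψ : n → ℂ) {ρ : Matrix n n ℂ} (hρ : IsState ρ) :
    ((1 - proj ψ) * ρ).trace.re = 1 - expVal ψ ρ := by
  rw [sub_mul, one_mul, trace_sub, hρ.2, Complex.sub_re, Complex.one_re, expVal_eq_re_trace]

end Expectation

/-! ### The GHZ basis -/

section Flip

variable {ι : Type*}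

/-- The bit string with all bits flipped, i.e. the action of `σ₁ ⊗ ⋯ ⊗ σ₁` on basis labels. -/
def flip (x : ι → Fin 2) : ι → Fin 2 := fun k => Fin.rev (x k)

lemma flip_apply (x : ι → Fin 2) (k : ι) : flip x k = Fin.rev (x k) := rfl

@[simp] lemma flip_flip (x : ι → Fin 2) : flip (flip x) = x := by
  funext k
  rw [flip_apply, flip_apply, Fin.rev_rev]

lemma rev_ne_self (a : Fin 2) : Fin.rev a ≠ a := by
  revert a; decide

lemma eq_rev_iff_ne {a b : Fin 2} : a = Fin.rev b ↔ a ≠ b := by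
  revert a b; decide

lemma flip_ne [Nonempty ι] (x : ι → Fin 2) : flip x ≠ x := fun h =>
  rev_ne_self _ (congrFun h (Classical.arbitrary ι))

end Flip

section Leader

variable {N : ℕ}

/-- The bit strings with leading bit `0`, written without presupposing `N ≠ 0` as in `Index`. -/
abbrev LeadingZero (N : ℕ) : Type := {i : Bits N // ∀ k : Fin N, (k : ℕ) = 0 → i k = 0}

variable [NeZero N]

lemma leadingZero_apply_zero (i : LeadingZero N) : i.1 0 = 0 := i.2 0 rfl

/-- The bit string with leading bit `0` among `x` and its flip. -/
def leader (x : Bits N) : LeadingZero N :=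
  ⟨if x 0 = 0 then x else flip x, fun k hk => by
    obtain rfl : k = 0 := Fin.ext hk
    split_ifs with h
    · exact h
    · exact (eq_rev_iff_ne.2 (Ne.symm h)).symm⟩

lemma coe_leader (x : Bits N) : (leader x : Bits N) = if x 0 = 0 then x else flip x := rfl

lemma leader_coe (i : LeadingZero N) : leader i.1 = i :=
  Subtype.ext (if_pos (leadingZero_apply_zero i))

lemma leader_flip (x : Bits N) : leader (flip x) = leader x := by
  refine Subtype.ext ?_
  rw [coe_leader, coe_leader, flip_flip]
  by_cases h : x 0 = 0
  · rw [if_pos h, if_neg (flip_apply x 0 ▸ h ▸ rev_ne_self (x 0))]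
  · rw [if_neg h, if_pos ((flip_apply x 0).trans (eq_rev_iff_ne.2 (Ne.symm h)).symm)]

lemma eq_leader_or_eq_flip (x : Bits N) : x = leader x ∨ x = flip (leader x).1 := by
  rw [coe_leader]
  split_ifs <;> simp

lemma leader_eq_leader_iff {x y : Bits N} : leader x = leader y ↔ x = y ∨ x = flip y := by
  constructor
  · intro h
    rcases eq_leader_or_eq_flip x with hx | hx <;> rcases eq_leader_or_eq_flip y with hy | hy <;>
      rw [hx, hy, h] <;> simp
  · rintro (rfl | rfl)
    · rfl
    · exact leader_flip y

end Leader

section Basis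

variable {N : ℕ}

lemma inv_sqrt_two_mul_self : ((√2 : ℝ) : ℂ)⁻¹ * ((√2 : ℝ) : ℂ)⁻¹ = 1 / 2 := by
  rw [← mul_inv, ← Complex.ofReal_mul, Real.mul_self_sqrt zero_le_two, Complex.ofReal_ofNat,
    one_div]

lemma sum_intUnits {M : Type*} [AddCommMonoid M] (f : ℤˣ → M) : ∑ s, f s = f 1 + f (-1) := by
  rw [show (Finset.univ : Finset ℤˣ) = {1, -1} from rfl, Finset.sum_pair (by decide)]

lemma star_ghzVec (b : Index N) : star (ghzVec b) = ghzVec b := by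
  funext x
  simp only [ghzVec, Pi.star_apply, Pi.smul_apply, Pi.add_apply, Pi.single_apply, smul_eq_mul]
  split_ifs <;> simp

lemma ghzVec_dotProduct (b : Index N) (v : Bits N → ℂ) :
    ghzVec b ⬝ᵥ v = ((√2 : ℝ) : ℂ)⁻¹ * (v b.1 + ((b.2 : ℤ) : ℂ) * v (flip b.1.1)) := by
  rw [ghzVec, smul_dotProduct, add_dotProduct, smul_dotProduct, single_one_dotProduct,
    single_one_dotProduct, smul_eq_mul, smul_eq_mul]
  rfl

lemma ghzDiag_eq_sum (p : Index N → ℝ) : ghzDiag p = ∑ b, p b • proj (ghzVec b) := rfl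

lemma ghzDiag_add (p q : Index N → ℝ) : ghzDiag (p + q) = ghzDiag p + ghzDiag q := by
  simp only [ghzDiag_eq_sum, Pi.add_apply, add_smul, Finset.sum_add_distrib]

lemma ghzDiag_smul (c : ℝ) (p : Index N → ℝ) : ghzDiag (c • p) = c • ghzDiag p := by
  simp only [ghzDiag_eq_sum, Pi.smul_apply, smul_assoc, Finset.smul_sum]

lemma ghzDiag_sub (p q : Index N → ℝ) : ghzDiag (p - q) = ghzDiag p - ghzDiag q := by
  simp only [ghzDiag_eq_sum, Pi.sub_apply, sub_smul, Finset.sum_sub_distrib]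

lemma ghzDiag_single (b : Index N) : ghzDiag (Pi.single b 1) = proj (ghzVec b) := by
  simp only [ghzDiag_eq_sum, Pi.single_apply, ite_smul, one_smul, zero_smul,
    Finset.sum_ite_eq', Finset.mem_univ, if_true]

lemma ghzDiag_isHermitian (p : Index N → ℝ) : (ghzDiag p).IsHermitian := by
  rw [ghzDiag_eq_sum, IsHermitian, conjTranspose_sum]
  refine Finset.sum_congr rfl fun b _ => ?_
  rw [conjTranspose_smul, (posSemidef_proj _).isHermitian.eq, star_trivial]

variable [NeZero N]

lemma ghzVec_apply (b : Index N) (x : Bits N) :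
    ghzVec b x =
      if b.1 = leader x then
        ((√2 : ℝ) : ℂ)⁻¹ * (if x 0 = 0 then 1 else ((b.2 : ℤ) : ℂ))
      else 0 := by
  have hx : ghzVec b x = ((√2 : ℝ) : ℂ)⁻¹ * ((if x = b.1 then 1 else 0) +
      ((b.2 : ℤ) : ℂ) * (if x = flip b.1.1 then 1 else 0)) := by
    simp only [ghzVec, Pi.smul_apply, Pi.add_apply, smul_eq_mul, Pi.single_apply]
    rfl
  obtain ⟨i, s⟩ := b
  rw [hx]
  rcases eq_or_ne i (leader x) with rfl | hi
  · rw [if_pos rfl, coe_leader]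
    by_cases h : x 0 = 0
    · simp [h, (flip_ne x).symm]
    · simp [h, (flip_ne x).symm]
  · rw [if_neg hi, if_neg, if_neg]
    · simp
    · rintro rfl
      exact hi (by rw [leader_flip, leader_coe])
    · rintro rfl
      exact hi (leader_coe i).symm

lemma star_ghzVec_dotProduct (b b' : Index N) :
    star (ghzVec b) ⬝ᵥ ghzVec b' = if b = b' then 1 else 0 := by
  obtain ⟨i, s⟩ := b
  obtain ⟨j, t⟩ := b'
  rw [star_ghzVec, ghzVec_dotProduct, ghzVec_apply, ghzVec_apply, leader_flip, leader_coe,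
    flip_apply, leadingZero_apply_zero, if_pos rfl, if_neg (rev_ne_self 0)]
  rcases eq_or_ne i j with rfl | hij
  · rw [if_pos rfl, if_pos rfl, mul_add, mul_left_comm _ ((s : ℤ) : ℂ), ← mul_assoc _ _ 1,
      ← mul_assoc _ _ ((t : ℤ) : ℂ), inv_sqrt_two_mul_self]
    rcases Int.units_eq_one_or s with rfl | rfl <;> rcases Int.units_eq_one_or t with rfl | rfl <;>
      norm_num
  · rw [if_neg hij.symm, if_neg hij.symm, if_neg fun h => hij (congrArg Prod.fst h)]
    ring

lemma star_ghzVec_dotProduct_self (b : Index N) : star (ghzVec b) ⬝ᵥ ghzVec b = 1 := by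
  rw [star_ghzVec_dotProduct, if_pos rfl]

lemma ghzVec_mul_ghzVec (s : ℤˣ) {x y : Bits N} (h : leader x = leader y) :
    ghzVec (leader x, s) x * ghzVec (leader x, s) y =
      1 / 2 * (if x = y then 1 else ((s : ℤ) : ℂ)) := by
  have hs : ((s : ℤ) : ℂ) * ((s : ℤ) : ℂ) = 1 := by
    rcases Int.units_eq_one_or s with rfl | rfl <;> norm_num
  have hentry : (if x 0 = 0 then (1 : ℂ) else ((s : ℤ) : ℂ)) *
      (if y 0 = 0 then 1 else ((s : ℤ) : ℂ)) = if x = y then 1 else ((s : ℤ) : ℂ) := by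
    rcases leader_eq_leader_iff.1 h with rfl | rfl
    · rw [if_pos rfl]
      split_ifs <;> simp only [one_mul, hs]
    · rw [if_neg (flip_ne y), flip_apply]
      obtain h0 | h1 : y 0 = 0 ∨ y 0 = 1 := by omega
      · simp [h0]
      · simp [h1]
  rw [ghzVec_apply, ghzVec_apply, if_pos rfl, if_pos h, mul_mul_mul_comm, hentry,
    inv_sqrt_two_mul_self]

lemma ghzDiag_apply (p : Index N → ℝ) (x y : Bits N) :
    ghzDiag p x y = if leader x = leader y then
      1 / 2 * ∑ s : ℤˣ, (p (leader x, s) : ℂ) * (if x = y then 1 else ((s : ℤ) : ℂ)) else 0 := by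
  have hsum : ghzDiag p x y = ∑ b, (p b : ℂ) * (ghzVec b x * ghzVec b y) := by
    simp only [ghzDiag, Matrix.sum_apply, Matrix.smul_apply, proj, vecMulVec_apply, star_ghzVec,
      smul_eq_mul]
  rw [hsum, Fintype.sum_prod_type, Finset.sum_eq_single (leader x) (fun i _ hi =>
    Finset.sum_eq_zero fun s _ => by rw [ghzVec_apply (i, s) x, if_neg hi]; ring) (by simp),
    Finset.mul_sum]
  by_cases h : leader x = leader y
  · rw [if_pos h]
    exact Finset.sum_congr rfl fun s _ => by rw [ghzVec_mul_ghzVec s h, mul_left_comm]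
  · rw [if_neg h]
    refine Finset.sum_eq_zero fun s _ => ?_
    rw [ghzVec_apply _ y, if_neg h, mul_zero, mul_zero]

lemma ghzDiag_one : ghzDiag (1 : Index N → ℝ) = 1 := by
  ext x y
  rw [ghzDiag_apply, Matrix.one_apply, sum_intUnits]
  rcases eq_or_ne x y with rfl | hxy
  · norm_num
  · simp [hxy]

lemma sum_proj_ghzVec : ∑ b : Index N, proj (ghzVec b) = 1 := by
  simpa only [ghzDiag_eq_sum, Pi.one_apply, one_smul] using ghzDiag_one (N := N)

lemma ghzDiag_mulVec_ghzVec (p : Index N → ℝ) (b : Index N) :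
    ghzDiag p *ᵥ ghzVec b = (p b : ℂ) • ghzVec b := by
  simp only [ghzDiag, sum_mulVec, smul_mulVec, proj, vecMulVec_mulVec, star_ghzVec_dotProduct]
  rw [Finset.sum_eq_single b (fun c _ hc => by simp [hc]) (by simp)]
  simp

lemma ghzDiag_mul (p q : Index N → ℝ) : ghzDiag p * ghzDiag q = ghzDiag (p * q) := by
  have hproj (b : Index N) : ghzDiag p * proj (ghzVec b) = (p b : ℂ) • proj (ghzVec b) := by
    rw [proj, mul_vecMulVec, ghzDiag_mulVec_ghzVec, smul_vecMulVec]
  simp only [ghzDiag.eq_1 q, ghzDiag.eq_1 (p * q), Finset.mul_sum, mul_smul_comm, hproj, smul_smul,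
    Pi.mul_apply, Complex.ofReal_mul, mul_comm]

lemma expVal_ghzDiag (p : Index N → ℝ) (b : Index N) : expVal (ghzVec b) (ghzDiag p) = p b := by
  rw [expVal_apply, ghzDiag_mulVec_ghzVec, dotProduct_smul, star_ghzVec_dotProduct_self,
    smul_eq_mul, mul_one, Complex.ofReal_re]

lemma trace_ghzDiag (p : Index N → ℝ) : (ghzDiag p).trace = ((∑ b, p b : ℝ) : ℂ) := by
  simp only [ghzDiag, trace_sum, trace_smul, trace_proj, star_ghzVec_dotProduct_self, smul_eq_mul,
    mul_one, Complex.ofReal_sum]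

lemma isState_ghzDiag {p : Index N → ℝ} (hp : p ∈ stdSimplex ℝ (Index N)) :
    IsState (ghzDiag p) :=
  ⟨posSemidef_sum _ fun b _ => (posSemidef_proj _).smul (Complex.zero_le_real.2 (hp.1 b)), by
    rw [trace_ghzDiag, hp.2, Complex.ofReal_one]⟩

lemma overlap_mem_stdSimplex {ρ : QOp N} (h : IsState ρ) :
    overlap ρ ∈ stdSimplex ℝ (Index N) := by
  refine ⟨fun b => expVal_nonneg (ghzVec b) h.1, ?_⟩
  calc ∑ b, overlap ρ b = ∑ b, (proj (ghzVec b) * ρ).trace.re :=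
        Finset.sum_congr rfl fun b _ => expVal_eq_re_trace _ _
    _ = ((∑ b, proj (ghzVec b)) * ρ).trace.re := by
        rw [Finset.sum_mul, trace_sum, Complex.re_sum]
    _ = 1 := by rw [sum_proj_ghzVec, one_mul, h.2, Complex.one_re]

end Basis

/-! ### Tensor products of single-qubit operators -/

section Tensor

variable {ι : Type*} [Fintype ι]

/-- The tensor product of single-qubit operators over an arbitrary index set of qubits; for
`ι = Fin N` it is `localOp`. The general case is needed for the parts of a partition. -/
def tensorOp (U : ι → Matrix (Fin 2) (Fin 2) ℂ) : Matrix (ι → Fin 2) (ι → Fin 2) ℂ :=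
  Matrix.of fun x y => ∏ k, U k (x k) (y k)

lemma tensorOp_apply (U : ι → Matrix (Fin 2) (Fin 2) ℂ) (x y : ι → Fin 2) :
    tensorOp U x y = ∏ k, U k (x k) (y k) := rfl

lemma localOp_eq_tensorOp {N : ℕ} (U : Fin N → Matrix (Fin 2) (Fin 2) ℂ) :
    localOp U = tensorOp U := rfl

lemma tensorOp_conjTranspose (U : ι → Matrix (Fin 2) (Fin 2) ℂ) :
    (tensorOp U)ᴴ = tensorOp fun k => (U k)ᴴ := by
  ext x y
  simp only [tensorOp_apply, conjTranspose_apply, star_prod]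

lemma tensorOp_one : tensorOp (1 : ι → Matrix (Fin 2) (Fin 2) ℂ) = 1 := by
  ext x y
  simp only [tensorOp_apply, Pi.one_apply, Matrix.one_apply, Fintype.prod_ite_zero,
    Finset.prod_const_one, funext_iff]

variable [DecidableEq ι]

lemma tensorOp_mul (U V : ι → Matrix (Fin 2) (Fin 2) ℂ) :
    tensorOp U * tensorOp V = tensorOp (U * V) := by
  ext x y
  simp only [tensorOp_apply, Pi.mul_apply, Matrix.mul_apply, ← Finset.prod_mul_distrib]
  rw [Finset.prod_univ_sum, Fintype.piFinset_univ]

lemma tensorOp_mem_unitaryGroup {U : ι → Matrix (Fin 2) (Fin 2) ℂ}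
    (hU : ∀ k, U k ∈ unitaryGroup (Fin 2) ℂ) : tensorOp U ∈ unitaryGroup (ι → Fin 2) ℂ := by
  rw [mem_unitaryGroup_iff', star_eq_conjTranspose, tensorOp_conjTranspose, tensorOp_mul,
    ← tensorOp_one]
  exact congrArg tensorOp (funext fun k => mem_unitaryGroup_iff'.1 (hU k))

end Tensor

/-! ### Separable states -/

section Separable

variable {N M : ℕ}

/-- Cutting a bit string into its restrictions to the parts of a partition. -/
def splitBits (part : Fin N → Fin M) :
    Bits N ≃ ((k : Fin M) → {i : Fin N // part i = k} → Fin 2) where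
  toFun x _ i := x i.1
  invFun z i := z (part i) ⟨i, rfl⟩
  left_inv _ := rfl
  right_inv z := by
    funext k i
    obtain ⟨i, rfl⟩ := i
    rfl

lemma prod_sum_splitBits {R : Type*} [CommSemiring R] (part : Fin N → Fin M)
    (f : (k : Fin M) → ({i : Fin N // part i = k} → Fin 2) → R) :
    ∏ k, ∑ z, f k z = ∑ x : Bits N, ∏ k, f k (fun i => x i.1) := by
  rw [Finset.prod_univ_sum, Fintype.piFinset_univ]
  exact ((splitBits part).sum_comp fun z => ∏ k, f k (z k)).symm

lemma star_dotProduct_self_of_isPureMSeparable {ψ : Bits N → ℂ} (h : IsPureMSeparable N M ψ) :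
    star ψ ⬝ᵥ ψ = 1 := by
  obtain ⟨part, -, φ, hφ, hψ⟩ := h
  rw [star_dotProduct_self_eq_one_iff]
  simp only [hψ, norm_prod, ← Finset.prod_pow]
  rw [← prod_sum_splitBits part fun k z => ‖φ k z‖ ^ 2]
  simp only [hφ, Finset.prod_const_one]

lemma isPureMSeparable_localOp_mulVec {ψ : Bits N → ℂ} (h : IsPureMSeparable N M ψ)
    {U : Fin N → Matrix (Fin 2) (Fin 2) ℂ} (hU : ∀ k, U k ∈ unitaryGroup (Fin 2) ℂ) :
    IsPureMSeparable N M (localOp U *ᵥ ψ) := by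
  obtain ⟨part, hp, φ, hφ, hψ⟩ := h
  refine ⟨part, hp, fun k => tensorOp (fun i : {i // part i = k} => U i.1) *ᵥ φ k, fun k => ?_,
    fun x => ?_⟩
  · have hUk := tensorOp_mem_unitaryGroup (U := fun i : {i // part i = k} => U i.1) fun i => hU i.1
    rw [← star_dotProduct_self_eq_one_iff,
      star_mulVec_dotProduct_mulVec (mem_unitaryGroup_iff'.1 hUk),
      star_dotProduct_self_eq_one_iff, hφ]
  · simp only [mulVec, dotProduct, localOp_eq_tensorOp, tensorOp_apply]
    rw [prod_sum_splitBits part fun k z =>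
      (∏ i : {i // part i = k}, U i.1 (x i.1) (z i)) * φ k z]
    refine Finset.sum_congr rfl fun y _ => ?_
    rw [Finset.prod_mul_distrib, hψ y, Fintype.prod_fiberwise part fun i => U i (x i) (y i)]

lemma isState_of_mem_mSeparable {σ : QOp N} (h : σ ∈ mSeparable N M) : IsState σ := by
  refine convexHull_min ?_ convex_setOf_isState h
  rintro _ ⟨ψ, hψ, rfl⟩
  exact isState_proj (star_dotProduct_self_of_isPureMSeparable hψ)

lemma isLinearMap_localConj (U : Fin N → Matrix (Fin 2) (Fin 2) ℂ) :
    IsLinearMap ℝ (localConj U) where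
  map_add ρ σ := by simp only [localConj, Matrix.mul_add, Matrix.add_mul]
  map_smul c ρ := by simp only [localConj, Matrix.mul_smul, Matrix.smul_mul]

lemma localConj_proj (U : Fin N → Matrix (Fin 2) (Fin 2) ℂ) (ψ : Bits N → ℂ) :
    localConj U (proj ψ) = proj (localOp U *ᵥ ψ) :=
  mul_proj_mul_conjTranspose _ ψ

lemma localConj_mem_mSeparable {σ : QOp N} (h : σ ∈ mSeparable N M)
    {U : Fin N → Matrix (Fin 2) (Fin 2) ℂ} (hU : ∀ k, U k ∈ unitaryGroup (Fin 2) ℂ) :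
    localConj U σ ∈ mSeparable N M := by
  refine convexHull_min ?_ ((convex_convexHull ℝ _).is_linear_preimage (isLinearMap_localConj U)) h
  rintro _ ⟨ψ, hψ, rfl⟩
  exact subset_convexHull ℝ _
    ⟨_, isPureMSeparable_localOp_mulVec hψ hU, localConj_proj U ψ⟩

lemma isState_localConj {ρ : QOp N} (h : IsState ρ) {U : Fin N → Matrix (Fin 2) (Fin 2) ℂ}
    (hU : ∀ k, U k ∈ unitaryGroup (Fin 2) ℂ) : IsState (localConj U ρ) := by
  refine ⟨h.1.mul_mul_conjTranspose_same _, ?_⟩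
  rw [localConj, trace_mul_comm, ← Matrix.mul_assoc, localOp_eq_tensorOp, ← star_eq_conjTranspose,
    mem_unitaryGroup_iff'.1 (tensorOp_mem_unitaryGroup hU), one_mul, h.2]

lemma norm_sq_add_norm_sq_flip_le {ι : Type*} [Fintype ι] [DecidableEq ι] [Nonempty ι]
    {φ : (ι → Fin 2) → ℂ} (h : ∑ y, ‖φ y‖ ^ 2 = 1) (x : ι → Fin 2) :
    ‖φ x‖ ^ 2 + ‖φ (flip x)‖ ^ 2 ≤ 1 := by
  rw [← h, ← Finset.sum_pair (f := fun y => ‖φ y‖ ^ 2) (flip_ne x).symm]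
  exact Finset.sum_le_sum_of_subset_of_nonneg (Finset.subset_univ _) fun _ _ _ => by positivity

lemma norm_intUnits (s : ℤˣ) : ‖((s : ℤ) : ℂ)‖ = 1 := by
  rcases Int.units_eq_one_or s with rfl | rfl <;> simp

lemma norm_add_norm_flip_le_one {ψ : Bits N → ℂ} (h : IsPureMSeparable N 2 ψ) (x : Bits N) :
    ‖ψ x‖ + ‖ψ (flip x)‖ ≤ 1 := by
  obtain ⟨part, hp, φ, hφ, hψ⟩ := h
  have hpart (k : Fin 2) : Nonempty {m // part m = k} := (hp k).elim fun m hm => ⟨⟨m, hm⟩⟩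
  have h₀ := norm_sq_add_norm_sq_flip_le (hφ 0) fun m => x m.1
  have h₁ := norm_sq_add_norm_sq_flip_le (hφ 1) fun m => x m.1
  rw [hψ, hψ, norm_prod, norm_prod, Fin.prod_univ_two, Fin.prod_univ_two]
  change ‖φ 0 fun m => x m.1‖ * ‖φ 1 fun m => x m.1‖ +
    ‖φ 0 (flip fun m => x m.1)‖ * ‖φ 1 (flip fun m => x m.1)‖ ≤ 1
  nlinarith [sq_nonneg (‖φ 0 fun m => x m.1‖ - ‖φ 1 fun m => x m.1‖),
    sq_nonneg (‖φ 0 (flip fun m => x m.1)‖ - ‖φ 1 (flip fun m => x m.1)‖)]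

lemma overlap_proj_le_half {ψ : Bits N → ℂ} (h : IsPureMSeparable N 2 ψ) (b : Index N) :
    overlap (proj ψ) b ≤ 1 / 2 := by
  have hnorm : ‖ψ b.1 + ((b.2 : ℤ) : ℂ) * ψ (flip b.1.1)‖ ≤ 1 := by
    refine (norm_add_le _ _).trans ?_
    rw [norm_mul, norm_intUnits, one_mul]
    exact norm_add_norm_flip_le_one h b.1
  calc overlap (proj ψ) b = ‖star (ghzVec b) ⬝ᵥ ψ‖ ^ 2 := expVal_proj _ _
    _ = 1 / 2 * ‖ψ b.1 + ((b.2 : ℤ) : ℂ) * ψ (flip b.1.1)‖ ^ 2 := by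
      rw [star_ghzVec, ghzVec_dotProduct, norm_mul, mul_pow, norm_inv, inv_pow, Complex.norm_real,
        Real.norm_eq_abs, sq_abs, Real.sq_sqrt zero_le_two, one_div]
    _ ≤ 1 / 2 := mul_le_of_le_one_right (by norm_num) (pow_le_one₀ (norm_nonneg _) hnorm)

lemma overlap_le_half_of_mem_mSeparable {σ : QOp N} (h : σ ∈ mSeparable N 2) (b : Index N) :
    overlap σ b ≤ 1 / 2 := by
  refine convexHull_min ?_ (convex_setOf_expVal_le (ghzVec b) (1 / 2)) h
  rintro _ ⟨ψ, hψ, rfl⟩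
  exact overlap_proj_le_half hψ b

end Separable

/-! ### Biseparable GHZ-diagonal states -/

section CappedSimplex

variable {ι : Type*} [Fintype ι]

lemma exists_ne_sum_mul_le {p : ι → ℝ} (hp : p ∈ stdSimplex ℝ ι) (hhalf : ∀ b, p b ≤ 1 / 2)
    (c : ι → ℝ) : ∃ a b, a ≠ b ∧ ∑ x, p x * c x ≤ 1 / 2 * (c a + c b) := by
  classical
  obtain ⟨hp0, hp1⟩ := hp
  have : Nonempty ι := by
    by_contra h
    rw [not_nonempty_iff] at h
    exact zero_ne_one ((Fintype.sum_empty p).symm.trans hp1)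
  obtain ⟨a, ha⟩ := Finite.exists_max c
  have hrest : ∑ x ∈ Finset.univ.erase a, p x = 1 - p a := by
    rw [← hp1, ← Finset.add_sum_erase _ p (Finset.mem_univ a), add_sub_cancel_left]
  have hne : (Finset.univ.erase a).Nonempty := by
    refine Finset.nonempty_of_sum_ne_zero (f := p) ?_
    linarith [hhalf a]
  obtain ⟨b, hb, hmax⟩ := Finset.exists_max_image _ c hne
  refine ⟨a, b, (Finset.ne_of_mem_erase hb).symm, ?_⟩
  calc ∑ x, p x * c x = p a * c a + ∑ x ∈ Finset.univ.erase a, p x * c x :=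
        (Finset.add_sum_erase _ _ (Finset.mem_univ a)).symm
    _ ≤ p a * c a + ∑ x ∈ Finset.univ.erase a, p x * c b := by
        gcongr with x hx
        · exact hp0 x
        · exact hmax x hx
    _ = c b + p a * (c a - c b) := by rw [← Finset.sum_mul, hrest]; ring
    _ ≤ c b + 1 / 2 * (c a - c b) := by
        gcongr
        · exact sub_nonneg.2 (ha b)
        · exact hhalf a
    _ = 1 / 2 * (c a + c b) := by ring

variable [DecidableEq ι]

/-- Otherwise a linear functional would be larger at `p` than at every vertex, which is impossible:
a distribution capped by `1/2` puts weight at most `1/2` on the largest coefficient. -/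
lemma mem_convexHull_midpoint_single {p : ι → ℝ} (hp : p ∈ stdSimplex ℝ ι)
    (hhalf : ∀ b, p b ≤ 1 / 2) :
    p ∈ convexHull ℝ {q : ι → ℝ | ∃ a b, a ≠ b ∧
      q = midpoint ℝ (Pi.single a 1 : ι → ℝ) (Pi.single b 1)} := by
  have hfin : {q : ι → ℝ | ∃ a b, a ≠ b ∧
      q = midpoint ℝ (Pi.single a 1 : ι → ℝ) (Pi.single b 1)}.Finite := by
    refine (Set.finite_range fun ab : ι × ι =>
      midpoint ℝ (Pi.single ab.1 1 : ι → ℝ) (Pi.single ab.2 1)).subset ?_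
    rintro _ ⟨a, b, -, rfl⟩
    exact ⟨(a, b), rfl⟩
  by_contra hnot
  obtain ⟨f, u, hhull, hu⟩ :=
    geometric_hahn_banach_closed_point (convex_convexHull ℝ _) (hfin.isClosed_convexHull ℝ) hnot
  obtain ⟨a, b, hab, hle⟩ := exists_ne_sum_mul_le hp hhalf fun x => f (Pi.single x 1)
  have hfp : f p = ∑ x, p x * f (Pi.single x 1) := by
    conv_lhs => rw [pi_eq_sum_univ' p]
    simp only [map_sum, map_smul, smul_eq_mul]
  have hmid := hhull _ (subset_convexHull ℝ _ ⟨a, b, hab, rfl⟩)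
  rw [midpoint_eq_smul_add, map_smul, map_add, smul_eq_mul, invOf_eq_inv] at hmid
  linarith

end CappedSimplex

section Splice

variable {N : ℕ} {part : Fin N → Fin 2}

/-- The bit string that agrees with `x` on part `0` and with `y` on part `1` of a bipartition. -/
def splice (part : Fin N → Fin 2) (x y : Bits N) : Bits N :=
  fun m => if part m = 0 then x m else y m

lemma single_restrict_mul_single_restrict (x y z : Bits N) :
    (Pi.single (fun m : {m // part m = 0} => x m.1) 1 : _ → ℂ) (fun m => z m.1) *
      (Pi.single (fun m : {m // part m = 1} => y m.1) 1 : _ → ℂ) (fun m => z m.1) =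
    (Pi.single (splice part x y) 1 : Bits N → ℂ) z := by
  have hiff : z = splice part x y ↔
      (fun m : {m // part m = 0} => z m.1) = (fun m => x m.1) ∧
        (fun m : {m // part m = 1} => z m.1) = fun m => y m.1 := by
    simp only [funext_iff, Subtype.forall, splice]
    refine ⟨fun h => ⟨fun m hm => ?_, fun m hm => ?_⟩, fun h m => ?_⟩
    · rw [h, if_pos hm]
    · rw [h, if_neg (by simp [hm])]
    · split_ifs with hm
      · exact h.1 m hm
      · exact h.2 m (by omega)
  simp only [Pi.single_apply, hiff, ite_and, ite_mul, one_mul, zero_mul]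

/-- The four terms come from expanding `(α₀|x⟩ + β₀|x̄⟩) ⊗ (α₁|x⟩ + β₁|x̄⟩)` over the two parts. -/
lemma isPureMSeparable_splice (hpart : Function.Surjective part) (x : Bits N) {α β : Fin 2 → ℂ}
    (hunit : ∀ k, ‖α k‖ ^ 2 + ‖β k‖ ^ 2 = 1) :
    IsPureMSeparable N 2 ((α 0 * α 1) • Pi.single x 1 +
      (α 0 * β 1) • Pi.single (splice part x (flip x)) 1 +
      (β 0 * α 1) • Pi.single (splice part (flip x) x) 1 +
      (β 0 * β 1) • Pi.single (flip x) 1) := by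
  refine ⟨part, hpart, fun k => α k • Pi.single (fun m => x m.1) 1 +
    β k • Pi.single (fun m => flip x m.1) 1, fun k => ?_, fun z => ?_⟩
  · obtain ⟨m, hm⟩ := hpart k
    have hne : (fun m : {m // part m = k} => flip x m.1) ≠ fun m => x m.1 := fun h =>
      rev_ne_self _ (congrFun h ⟨m, hm⟩)
    rw [← hunit k, ← Finset.sum_subset (Finset.subset_univ {fun m => x m.1, fun m => flip x m.1}),
      Finset.sum_pair hne.symm]
    · simp [hne, hne.symm]
    · intro y _ hy
      simp only [Finset.mem_insert, Finset.mem_singleton, not_or] at hy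
      simp [hy.1, hy.2]
  · have hself (y : Bits N) : splice part y y = y := funext fun m => ite_self _
    have hxx := single_restrict_mul_single_restrict (part := part) x x z
    have hyy := single_restrict_mul_single_restrict (part := part) (flip x) (flip x) z
    rw [hself] at hxx hyy
    simp only [Fin.prod_univ_two, Pi.add_apply, Pi.smul_apply, smul_eq_mul, ← hxx, ← hyy,
      ← single_restrict_mul_single_restrict]
    ring

end Splice

section HalfPairs

variable {N : ℕ}

lemma ghzVec_eq_single_add (b : Index N) :
    ghzVec b = ((√2 : ℝ) : ℂ)⁻¹ •
      (Pi.single b.1.1 1 + ((b.2 : ℤ) : ℂ) • Pi.single (flip b.1.1) 1) := rfl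

lemma isPureMSeparable_smul_single (hN : 2 ≤ N) (x : Bits N) {c : ℂ} (hc : ‖c‖ = 1) :
    IsPureMSeparable N 2 (c • Pi.single x 1) := by
  have hpart : Function.Surjective fun m : Fin N => if (m : ℕ) = 0 then (0 : Fin 2) else 1 := by
    refine Fin.forall_fin_two.2 ⟨⟨⟨0, by omega⟩, if_pos rfl⟩, ⟨⟨1, by omega⟩, if_neg one_ne_zero⟩⟩
  simpa using isPureMSeparable_splice hpart x (α := ![c, 1]) (β := 0)
    (Fin.forall_fin_two.2 ⟨by simp [hc], by simp⟩)

/-- The bipartition separates the qubits where the two bit strings agree from those where they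
differ. -/
lemma exists_splice_flip_eq [NeZero N] {i j : LeadingZero N} (hij : i ≠ j) :
    ∃ part : Fin N → Fin 2, Function.Surjective part ∧
      splice part i (flip i.1) = j ∧ splice part (flip i.1) i = flip j.1 := by
  obtain ⟨m, hm⟩ := Function.ne_iff.1 (Subtype.coe_injective.ne hij)
  have hpart (m : Fin N) : (if i.1 m = j.1 m then (0 : Fin 2) else 1) = 0 ↔ i.1 m = j.1 m := by
    simp
  refine ⟨fun m => if i.1 m = j.1 m then 0 else 1,
    Fin.forall_fin_two.2 ⟨⟨0, if_pos ?_⟩, ⟨m, if_neg hm⟩⟩, funext fun m => ?_, funext fun m => ?_⟩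
  · rw [leadingZero_apply_zero, leadingZero_apply_zero]
  all_goals
    simp only [splice, hpart]
    split_ifs with h
  · exact h
  · exact (eq_rev_iff_ne.2 (Ne.symm h)).symm
  · exact congrArg Fin.rev h
  · exact eq_rev_iff_ne.2 h

/-- The condition on `c` makes the coefficients of the four computational basis vectors factorise
over the two parts of `exists_splice_flip_eq`. -/
lemma isPureMSeparable_ghzVec_add [NeZero N] {i j : LeadingZero N} (hij : i ≠ j) (s t : ℤˣ) {c : ℂ}
    (hc : c ^ 2 = ((s : ℤ) : ℂ) * ((t : ℤ) : ℂ)) :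
    IsPureMSeparable N 2 (((√2 : ℝ) : ℂ)⁻¹ • (ghzVec (i, s) + c • ghzVec (j, t))) := by
  obtain ⟨part, hpart, hj, hfj⟩ := exists_splice_flip_eq hij
  set r : ℂ := ((√2 : ℝ) : ℂ)⁻¹ with hr
  have hcnorm : ‖c‖ ^ 2 = 1 := by
    rw [← norm_pow, hc, norm_mul, norm_intUnits, norm_intUnits, one_mul]
  have hrnorm : ‖r‖ ^ 2 = 1 / 2 := by
    rw [← norm_pow, sq, inv_sqrt_two_mul_self]
    norm_num
  have ht : ((t : ℤ) : ℂ) * ((t : ℤ) : ℂ) = 1 := by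
    rcases Int.units_eq_one_or t with rfl | rfl <;> norm_num
  have hs : ((s : ℤ) : ℂ) = c * (t : ℤ) * c := by
    linear_combination -((t : ℤ) : ℂ) * hc - ((s : ℤ) : ℂ) * ht
  have hsep := isPureMSeparable_splice hpart i (α := fun _ => r) (β := ![r * (c * (t : ℤ)), r * c])
    (Fin.forall_fin_two.2 ⟨by
      rw [cons_val_zero, norm_mul, norm_mul, mul_pow, mul_pow, hrnorm, hcnorm, norm_intUnits]
      norm_num, by
      rw [cons_val_one, cons_val_zero, norm_mul, mul_pow, hrnorm, hcnorm]
      norm_num⟩)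
  convert hsep using 1
  rw [hj, hfj, ghzVec_eq_single_add, ghzVec_eq_single_add, ← hr]
  simp only [cons_val_zero, cons_val_one, hs]
  module

/-- The midpoint is also the midpoint of `½|φ + ψ⟩⟨φ + ψ|` and `½|φ - ψ⟩⟨φ - ψ|`. -/
lemma midpoint_proj_mem_mSeparable {φ ψ : Bits N → ℂ} {M : ℕ}
    (hadd : IsPureMSeparable N M (((√2 : ℝ) : ℂ)⁻¹ • (φ + ψ)))
    (hsub : IsPureMSeparable N M (((√2 : ℝ) : ℂ)⁻¹ • (φ - ψ))) :
    midpoint ℝ (proj φ) (proj ψ) ∈ mSeparable N M := by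
  have hnorm : ‖((√2 : ℝ) : ℂ)⁻¹‖ ^ 2 = 1 / 2 := by
    rw [← norm_pow, sq, inv_sqrt_two_mul_self]
    norm_num
  have hmid : midpoint ℝ (proj φ) (proj ψ) =
      midpoint ℝ (proj (((√2 : ℝ) : ℂ)⁻¹ • (φ + ψ))) (proj (((√2 : ℝ) : ℂ)⁻¹ • (φ - ψ))) := by
    rw [midpoint_eq_smul_add, midpoint_eq_smul_add, proj_smul, proj_smul, ← smul_add,
      proj_add_add_proj_sub, hnorm, smul_smul (1 / 2 : ℝ) 2]
    norm_num
  rw [hmid]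
  exact (convex_convexHull ℝ _).midpoint_mem (subset_convexHull ℝ _ ⟨_, hadd, rfl⟩)
    (subset_convexHull ℝ _ ⟨_, hsub, rfl⟩)

lemma midpoint_proj_ghzVec_mem_mSeparable (hN : 2 ≤ N) {a b : Index N} (hab : a ≠ b) :
    midpoint ℝ (proj (ghzVec a)) (proj (ghzVec b)) ∈ mSeparable N 2 := by
  have : NeZero N := ⟨by omega⟩
  obtain ⟨i, s⟩ := a
  obtain ⟨j, t⟩ := b
  rcases eq_or_ne i j with rfl | hij
  · obtain rfl : t = -s := Int.units_ne_iff_eq_neg.1 fun h => hab (by rw [h])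
    refine midpoint_proj_mem_mSeparable ?_ ?_
    · convert isPureMSeparable_smul_single hN i.1 norm_one using 1
      rw [ghzVec_eq_single_add, ghzVec_eq_single_add, ← smul_add, smul_smul, inv_sqrt_two_mul_self]
      push_cast
      module
    · convert isPureMSeparable_smul_single hN (flip i.1) (norm_intUnits s) using 1
      rw [ghzVec_eq_single_add, ghzVec_eq_single_add, ← smul_sub, smul_smul, inv_sqrt_two_mul_self]
      push_cast
      module
  · obtain ⟨c, hc⟩ := IsAlgClosed.exists_pow_nat_eq (((s : ℤ) : ℂ) * ((t : ℤ) : ℂ)) two_pos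
    have hcnorm : ‖c‖ ^ 2 = 1 := by
      rw [← norm_pow, hc, norm_mul, norm_intUnits, norm_intUnits, one_mul]
    have hproj : proj (ghzVec (j, t)) = proj (c • ghzVec (j, t)) := by
      rw [proj_smul, hcnorm, one_smul]
    rw [hproj]
    refine midpoint_proj_mem_mSeparable (isPureMSeparable_ghzVec_add hij s t hc) ?_
    rw [sub_eq_add_neg, ← neg_smul]
    exact isPureMSeparable_ghzVec_add hij s t (by rw [neg_sq, hc])

end HalfPairs

section Criterion

variable {N : ℕ}

lemma ghzDiag_mem_mSeparable (hN : 2 ≤ N) {p : Index N → ℝ} (hp : p ∈ stdSimplex ℝ (Index N))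
    (hhalf : ∀ b, p b ≤ 1 / 2) : ghzDiag p ∈ mSeparable N 2 := by
  have hlin : IsLinearMap ℝ (ghzDiag : (Index N → ℝ) → QOp N) := ⟨ghzDiag_add, ghzDiag_smul⟩
  refine convexHull_min ?_ ((convex_convexHull ℝ _).is_linear_preimage hlin)
    (mem_convexHull_midpoint_single hp hhalf)
  rintro _ ⟨a, b, hab, rfl⟩
  have hmid := midpoint_proj_ghzVec_mem_mSeparable hN hab
  rwa [← ghzDiag_single, ← ghzDiag_single, midpoint_eq_smul_add, ← ghzDiag_add, ← ghzDiag_smul,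
    ← midpoint_eq_smul_add] at hmid

lemma ghzDiag_mem_mSeparable_iff (hN : 2 ≤ N) {p : Index N → ℝ} (hp : p ∈ stdSimplex ℝ (Index N))
    {b₀ : Index N} (hmax : ∀ b, p b ≤ p b₀) : ghzDiag p ∈ mSeparable N 2 ↔ p b₀ ≤ 1 / 2 := by
  have : NeZero N := ⟨by omega⟩
  refine ⟨fun h => ?_, fun h => ghzDiag_mem_mSeparable hN hp fun b => (hmax b).trans h⟩
  rw [← expVal_ghzDiag p b₀]
  exact overlap_le_half_of_mem_mSeparable h b₀

end Criterion

/-! ### GHZ-diagonalisation by local unitaries -/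

section Twirl

variable {n : ℕ}

/-- The single-qubit operator `σ₁^a · diag(1, t)`. -/
def flipPhase (a : Bool) (t : ℤˣ) : Matrix (Fin 2) (Fin 2) ℂ :=
  Matrix.of fun i j => if j = (if a then Fin.rev i else i) then
    (if j = 0 then 1 else ((t : ℤ) : ℂ)) else 0

lemma flipPhase_mem_unitaryGroup (a : Bool) (t : ℤˣ) :
    flipPhase a t ∈ unitaryGroup (Fin 2) ℂ := by
  rw [mem_unitaryGroup_iff]
  ext i j
  rcases Int.units_eq_one_or t with rfl | rfl <;> cases a <;> fin_cases i <;> fin_cases j <;>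
    simp [flipPhase, Matrix.mul_apply, Matrix.star_apply]

/-- Signs `t` with `∏ₖ tₖ = 1`, of which all but the leading one are the free parameters `s`. -/
def twirlPhase (s : Fin n → ℤˣ) : Fin (n + 1) → ℤˣ := Fin.cons (∏ j, s j) s

/-- The local unitaries `(σ₁^a)^{⊗(n+1)} · ⨂ₖ diag(1, tₖ)` with `∏ₖ tₖ = 1`, which permute the GHZ
basis up to signs. -/
def twirlUnitary (a : Bool) (s : Fin n → ℤˣ) (k : Fin (n + 1)) : Matrix (Fin 2) (Fin 2) ℂ :=
  flipPhase a (twirlPhase s k)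

/-- The sign by which `⨂ₖ diag(1, tₖ)` multiplies `|x⟩`. -/
def twirlSign (s : Fin n → ℤˣ) (x : Bits (n + 1)) : ℤˣ :=
  ∏ k, if x (Fin.succ k) = x 0 then 1 else s k

lemma prod_twirlPhase_eq_twirlSign (s : Fin n → ℤˣ) (x : Bits (n + 1)) :
    (∏ k, if x k = 0 then 1 else twirlPhase s k) = twirlSign s x := by
  rw [Fin.prod_univ_succ, twirlSign]
  simp only [twirlPhase, Fin.cons_zero, Fin.cons_succ]
  obtain h | h : x 0 = 0 ∨ x 0 = 1 := by omega
  · simp only [h, if_true, one_mul]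
  · rw [h, if_neg one_ne_zero, ← Finset.prod_mul_distrib]
    refine Finset.prod_congr rfl fun k _ => ?_
    obtain hk | hk : x k.succ = 0 ∨ x k.succ = 1 := by omega
    · simp [hk]
    · simp [hk]

lemma localOp_twirlUnitary (a : Bool) (s : Fin n → ℤˣ) (x y : Bits (n + 1)) :
    localOp (twirlUnitary a s) x y =
      if y = (if a then flip x else x) then ((twirlSign s y : ℤ) : ℂ) else 0 := by
  have hall : (∀ k ∈ Finset.univ, y k = if a then Fin.rev (x k) else x k) ↔
      y = if a then flip x else x := by
    rw [funext_iff]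
    cases a <;> simp [flip_apply]
  simp only [localOp, twirlUnitary, flipPhase, Matrix.of_apply, Finset.prod_ite_zero, hall,
    ← prod_twirlPhase_eq_twirlSign, Units.coe_prod, Int.cast_prod, apply_ite Units.val,
    apply_ite (Int.cast : ℤ → ℂ), Units.val_one, Int.cast_one]

lemma localConj_twirlUnitary (a : Bool) (s : Fin n → ℤˣ) (ρ : QOp (n + 1)) (x y : Bits (n + 1)) :
    localConj (twirlUnitary a s) ρ x y =
      (((twirlSign s (if a then flip x else x) * twirlSign s (if a then flip y else y) : ℤˣ) : ℤ) :
        ℂ) * ρ (if a then flip x else x) (if a then flip y else y) := by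
  simp only [localConj, Matrix.mul_apply, conjTranspose_apply, localOp_twirlUnitary, ite_mul,
    zero_mul, apply_ite star, star_zero, mul_ite, mul_zero, Finset.sum_ite_eq', Finset.mem_univ,
    if_true, star_intCast, Units.val_mul, Int.cast_mul]
  ring

lemma leader_eq_leader_iff_forall {x y : Bits (n + 1)} :
    leader x = leader y ↔ ∀ k : Fin n, (x k.succ = x 0 ↔ y k.succ = y 0) := by
  rw [leader_eq_leader_iff]
  constructor
  · rintro (rfl | rfl) k
    · rfl
    · rw [flip_apply, flip_apply, Fin.rev_inj]
  · intro h
    rcases eq_or_ne (x 0) (y 0) with h0 | h0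
    · refine Or.inl (funext (Fin.cases h0 fun k => ?_))
      have := h k
      omega
    · refine Or.inr (funext (Fin.cases (eq_rev_iff_ne.2 h0) fun k => eq_rev_iff_ne.2 ?_))
      have := h k
      omega

lemma sum_twirlSign_mul_twirlSign (x y : Bits (n + 1)) :
    ∑ s : Fin n → ℤˣ, (((twirlSign s x * twirlSign s y : ℤˣ) : ℤ) : ℂ) =
      if leader x = leader y then 2 ^ n else 0 := by
  have hsign (s : Fin n → ℤˣ) : (((twirlSign s x * twirlSign s y : ℤˣ) : ℤ) : ℂ) =
      ∏ k, if x k.succ = x 0 ↔ y k.succ = y 0 then 1 else ((s k : ℤ) : ℂ) := by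
    rw [twirlSign, twirlSign, ← Finset.prod_mul_distrib, Units.coe_prod, Int.cast_prod]
    refine Finset.prod_congr rfl fun k _ => ?_
    have hs := Int.units_mul_self (s k)
    by_cases hx : x k.succ = x 0 <;> by_cases hy : y k.succ = y 0 <;> simp [hx, hy, hs]
  have hsum (k : Fin n) :
      ∑ u : ℤˣ, (if x k.succ = x 0 ↔ y k.succ = y 0 then (1 : ℂ) else ((u : ℤ) : ℂ)) =
        if x k.succ = x 0 ↔ y k.succ = y 0 then 2 else 0 := by
    rw [sum_intUnits]
    split_ifs <;> norm_num
  calc _ = ∏ k : Fin n,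
        ∑ u : ℤˣ, (if x k.succ = x 0 ↔ y k.succ = y 0 then (1 : ℂ) else ((u : ℤ) : ℂ)) := by
        simp only [hsign, Finset.prod_univ_sum, Fintype.piFinset_univ]
    _ = _ := by
        simp only [hsum, Finset.prod_ite_zero, leader_eq_leader_iff_forall, Finset.mem_univ,
          true_imp_iff, Finset.prod_const, Finset.card_univ, Fintype.card_fin]

lemma coe_overlap {N : ℕ} {ρ : QOp N} (h : ρ.IsHermitian) (i : LeadingZero N) (s : ℤˣ) :
    (overlap ρ (i, s) : ℂ) = 1 / 2 * (ρ i.1 i.1 + ρ (flip i.1) (flip i.1) +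
      ((s : ℤ) : ℂ) * (ρ i.1 (flip i.1) + ρ (flip i.1) i.1)) := by
  have hs : ((s : ℤ) : ℂ) * ((s : ℤ) : ℂ) = 1 := by
    rcases Int.units_eq_one_or s with rfl | rfl <;> norm_num
  have hmul (x : Bits N) :
      (ρ *ᵥ ghzVec (i, s)) x = ((√2 : ℝ) : ℂ)⁻¹ * (ρ x i.1 + ((s : ℤ) : ℂ) * ρ x (flip i.1)) := by
    rw [mulVec, dotProduct_comm, ghzVec_dotProduct]
  calc (overlap ρ (i, s) : ℂ) = star (ghzVec (i, s)) ⬝ᵥ ρ *ᵥ ghzVec (i, s) := coe_expVal _ h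
    _ = _ := by
      rw [star_ghzVec, ghzVec_dotProduct, hmul, hmul]
      linear_combination (ρ i.1 i.1 + ((s : ℤ) : ℂ) * ((s : ℤ) : ℂ) * ρ (flip i.1) (flip i.1) +
        ((s : ℤ) : ℂ) * (ρ i.1 (flip i.1) + ρ (flip i.1) i.1)) * inv_sqrt_two_mul_self +
        1 / 2 * ρ (flip i.1) (flip i.1) * hs

lemma ghzDiag_overlap_apply {N : ℕ} [NeZero N] {ρ : QOp N} (h : ρ.IsHermitian) (x y : Bits N) :
    ghzDiag (overlap ρ) x y =
      if leader x = leader y then 1 / 2 * (ρ x y + ρ (flip x) (flip y)) else 0 := by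
  rw [ghzDiag_apply]
  by_cases hxy : leader x = leader y
  · rw [if_pos hxy, if_pos hxy, sum_intUnits, coe_overlap h, coe_overlap h]
    rcases leader_eq_leader_iff.1 hxy with rfl | rfl
    · rw [if_pos rfl, if_pos rfl]
      rcases eq_leader_or_eq_flip x with hx | hx
      all_goals
        generalize leader x = i at hx
        subst hx
        push_cast [flip_flip]
        ring
    · rw [leader_flip, if_neg (flip_ne y), if_neg (flip_ne y), flip_flip]
      rcases eq_leader_or_eq_flip y with hy | hy
      all_goals
        generalize leader y = i at hy
        subst hy
        push_cast [flip_flip]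
        ring
  · rw [if_neg hxy, if_neg hxy]

lemma sum_localConj_twirlUnitary {ρ : QOp (n + 1)} (h : ρ.IsHermitian) :
    ∑ j : Bool × (Fin n → ℤˣ), ((2 ^ (n + 1) : ℝ)⁻¹) • localConj (twirlUnitary j.1 j.2) ρ =
      ghzDiag (overlap ρ) := by
  ext x y
  rw [ghzDiag_overlap_apply h, Matrix.sum_apply, Fintype.sum_prod_type]
  simp only [Matrix.smul_apply, localConj_twirlUnitary, Fintype.sum_bool, if_true,
    Bool.false_eq_true, if_false]
  rw [← Finset.smul_sum, ← Finset.smul_sum, ← Finset.sum_mul, ← Finset.sum_mul,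
    sum_twirlSign_mul_twirlSign, sum_twirlSign_mul_twirlSign, leader_flip, leader_flip]
  split_ifs
  · simp only [Complex.real_smul]
    push_cast
    field_simp
    ring
  · simp only [zero_mul, smul_zero, add_zero]

lemma exists_ghzDiagonalisation {N : ℕ} (hN : 2 ≤ N) :
    ∃ (K : ℕ) (w : Fin K → ℝ) (U : Fin K → Fin N → Matrix (Fin 2) (Fin 2) ℂ),
      w ∈ stdSimplex ℝ (Fin K) ∧ (∀ j k, U j k ∈ unitaryGroup (Fin 2) ℂ) ∧
      ∀ ρ : QOp N, IsState ρ → overlap ρ ∈ stdSimplex ℝ (Index N) ∧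
        ∑ j, w j • localConj (U j) ρ = ghzDiag (overlap ρ) := by
  obtain ⟨n, rfl⟩ : ∃ n, N = n + 1 := ⟨N - 1, by omega⟩
  let e := Fintype.equivFin (Bool × (Fin n → ℤˣ))
  refine ⟨_, fun _ => (2 ^ (n + 1) : ℝ)⁻¹, fun j => twirlUnitary (e.symm j).1 (e.symm j).2,
    ⟨fun _ => by positivity, ?_⟩, fun j k => flipPhase_mem_unitaryGroup _ _,
    fun ρ hρ => ⟨overlap_mem_stdSimplex hρ, ?_⟩⟩
  · have hcard : Fintype.card (Bool × (Fin n → ℤˣ)) = 2 ^ (n + 1) := by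
      rw [Fintype.card_prod, Fintype.card_fun, Fintype.card_bool, Fintype.card_fin,
        Fintype.card_units_int, pow_succ']
    rw [Finset.sum_const, Finset.card_univ, Fintype.card_fin, hcard, nsmul_eq_mul]
    push_cast
    exact mul_inv_cancel₀ (by positivity)
  · rw [← sum_localConj_twirlUnitary hρ.1.isHermitian]
    exact e.symm.sum_comp fun j => ((2 ^ (n + 1) : ℝ)⁻¹) • localConj (twirlUnitary j.1 j.2) ρ

end Twirl

/-! ### Reduction to a two-outcome bound -/

section PointMix

variable {ι : Type*} [DecidableEq ι]

/-- The weights that put mass `P` on `b₀` and distribute the rest according to `r`. Used with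
`r b₀ = 0`, so that `P` is the weight of `b₀`. -/
def pointMix (b₀ : ι) (r : ι → ℝ) (P : ℝ) : ι → ℝ := P • Pi.single b₀ 1 + (1 - P) • r

lemma pointMix_self {b₀ : ι} {r : ι → ℝ} (hr : r b₀ = 0) (P : ℝ) : pointMix b₀ r P b₀ = P := by
  simp [pointMix, hr]

lemma pointMix_of_ne {b b₀ : ι} (h : b ≠ b₀) (r : ι → ℝ) (P : ℝ) :
    pointMix b₀ r P b = (1 - P) * r b := by
  simp [pointMix, h]

variable [Fintype ι]

lemma pointMix_mem_stdSimplex (b₀ : ι) {r : ι → ℝ} (hr : r ∈ stdSimplex ℝ ι) {P : ℝ}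
    (h0 : 0 ≤ P) (h1 : P ≤ 1) : pointMix b₀ r P ∈ stdSimplex ℝ ι :=
  convex_stdSimplex ℝ ι (single_mem_stdSimplex ℝ b₀) hr h0 (sub_nonneg.2 h1) (by ring)

lemma exists_eq_pointMix [Nontrivial ι] {p : ι → ℝ} (hp : p ∈ stdSimplex ℝ ι) (b₀ : ι) :
    ∃ r ∈ stdSimplex ℝ ι, r b₀ = 0 ∧ p = pointMix b₀ r (p b₀) := by
  have hsum : ∑ b ∈ {b₀}ᶜ, p b = 1 - p b₀ := by
    rw [← hp.2, ← Finset.sum_add_sum_compl {b₀}, Finset.sum_singleton, add_sub_cancel_left]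
  rcases (mem_Icc_of_mem_stdSimplex hp b₀).2.eq_or_lt with h1 | h1
  · obtain ⟨b₁, hb₁⟩ := exists_ne b₀
    have hzero : ∀ b ∈ ({b₀}ᶜ : Finset ι), p b = 0 :=
      (Finset.sum_eq_zero_iff_of_nonneg fun b _ => hp.1 b).1 (by rw [hsum, h1, sub_self])
    refine ⟨Pi.single b₁ 1, single_mem_stdSimplex ℝ b₁, Pi.single_eq_of_ne hb₁.symm _, ?_⟩
    funext b
    rcases eq_or_ne b b₀ with rfl | hb
    · rw [pointMix_self (Pi.single_eq_of_ne hb₁.symm _)]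
    · rw [pointMix_of_ne hb, h1, sub_self, zero_mul, hzero b (by simpa using hb)]
  · have hpos : 0 < 1 - p b₀ := sub_pos.2 h1
    let r : ι → ℝ := (1 - p b₀)⁻¹ • (p - Pi.single b₀ (p b₀))
    have hr0 : r b₀ = 0 := by simp [r]
    have hr (b : ι) (hb : b ≠ b₀) : r b = (1 - p b₀)⁻¹ * p b := by simp [r, hb]
    refine ⟨r, ⟨fun b => ?_, ?_⟩, hr0, ?_⟩
    · rcases eq_or_ne b b₀ with rfl | hb
      · exact hr0.ge
      · rw [hr b hb]
        exact mul_nonneg (inv_nonneg.2 hpos.le) (hp.1 b)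
    · simp only [r, Pi.smul_apply, Pi.sub_apply, smul_eq_mul, ← Finset.mul_sum,
        Finset.sum_sub_distrib, hp.2, Finset.sum_pi_single', Finset.mem_univ, if_true,
        inv_mul_cancel₀ hpos.ne']
    · funext b
      rcases eq_or_ne b b₀ with rfl | hb
      · rw [pointMix_self hr0]
      · rw [pointMix_of_ne hb, hr b hb, mul_inv_cancel_left₀ hpos.ne']

end PointMix

section Reduction

variable {N : ℕ}

instance : Nontrivial (Index N) :=
  have : Nonempty (LeadingZero N) := ⟨⟨0, fun _ _ => rfl⟩⟩
  have : Nontrivial ℤˣ := ⟨1, -1, by decide⟩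
  nontrivial_prod_right

lemma ghzDiag_pointMix (b₀ : Index N) (r : Index N → ℝ) (P : ℝ) :
    ghzDiag (pointMix b₀ r P) = P • proj (ghzVec b₀) + (1 - P) • ghzDiag r := by
  rw [pointMix, ghzDiag_add, ghzDiag_smul, ghzDiag_smul, ghzDiag_single]

lemma ghzDiag_pointMix_half_mem_mSeparable (hN : 2 ≤ N) {b₀ : Index N} {r : Index N → ℝ}
    (hr : r ∈ stdSimplex ℝ (Index N)) (hr0 : r b₀ = 0) :
    ghzDiag (pointMix b₀ r (1 / 2)) ∈ mSeparable N 2 := by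
  refine ghzDiag_mem_mSeparable hN
    (pointMix_mem_stdSimplex b₀ hr one_half_pos.le one_half_lt_one.le) fun b => ?_
  rcases eq_or_ne b b₀ with rfl | hb
  · rw [pointMix_self hr0]
  · rw [pointMix_of_ne hb]
    linarith [(mem_Icc_of_mem_stdSimplex hr b).2]

lemma entanglement_le {M : ℕ} (D : QOp N → QOp N → ℝ≥0∞) (ρ : QOp N) {ς : QOp N}
    (hς : ς ∈ mSeparable N M) : entanglement M D ρ ≤ D ρ ς :=
  iInf₂_le ς hς

/-- The function `g` is the least value of the distance `D` between two states whose overlaps with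
some unit vector are `P > 1/2` and at most `1/2`. The field `attained` asks this of GHZ-diagonal
states, where the overlap `P` with a GHZ basis vector is lowered to `1/2` and the other weights are
rescaled. -/
structure SharpOverlapBound (N : ℕ) (D : QOp N → QOp N → ℝ≥0∞) (g : ℝ → ℝ≥0∞) : Prop where
  self : ∀ ρ, IsState ρ → D ρ ρ = 0
  lower : ∀ ψ, star ψ ⬝ᵥ ψ = 1 → ∀ ρ σ, IsState ρ → IsState σ →
    1 / 2 < expVal ψ ρ → expVal ψ σ ≤ 1 / 2 → g (expVal ψ ρ) ≤ D ρ σ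
  attained : ∀ b₀, ∀ r ∈ stdSimplex ℝ (Index N), r b₀ = 0 → ∀ P, 1 / 2 < P → P ≤ 1 →
    D (ghzDiag (pointMix b₀ r P)) (ghzDiag (pointMix b₀ r (1 / 2))) = g P

namespace SharpOverlapBound

variable {D : QOp N → QOp N → ℝ≥0∞} {g : ℝ → ℝ≥0∞}

lemma le_entanglement [NeZero N] (h : SharpOverlapBound N D g) {ρ : QOp N} (hρ : IsState ρ)
    {U : Fin N → Matrix (Fin 2) (Fin 2) ℂ} (hU : ∀ k, U k ∈ unitaryGroup (Fin 2) ℂ) {b : Index N}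
    (hb : 1 / 2 < overlap (localConj U ρ) b) :
    g (overlap (localConj U ρ) b) ≤ entanglement 2 D ρ := by
  refine le_iInf₂ fun ς hς => ?_
  have hoverlap (τ : QOp N) :
      overlap (localConj U τ) b = expVal ((localOp U)ᴴ *ᵥ ghzVec b) τ :=
    expVal_mul_mul_conjTranspose _ τ _
  have hς' := overlap_le_half_of_mem_mSeparable (localConj_mem_mSeparable hς hU) b
  rw [hoverlap] at hb hς' ⊢
  refine h.lower _ ?_ ρ ς hρ (isState_of_mem_mSeparable hς) hb hς'
  rw [star_mulVec_dotProduct_mulVec, star_ghzVec_dotProduct_self]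
  rw [conjTranspose_conjTranspose, localOp_eq_tensorOp]
  exact mem_unitaryGroup_iff.1 (tensorOp_mem_unitaryGroup hU)

lemma le_of_mem_mSeparable [NeZero N] (h : SharpOverlapBound N D g) {p : Index N → ℝ}
    (hp : p ∈ stdSimplex ℝ (Index N)) {b₀ : Index N} (hb₀ : 1 / 2 < p b₀) {ς : QOp N}
    (hς : ς ∈ mSeparable N 2) : g (p b₀) ≤ D (ghzDiag p) ς := by
  have hlow := h.lower (ghzVec b₀) (star_ghzVec_dotProduct_self b₀) (ghzDiag p) ς
    (isState_ghzDiag hp) (isState_of_mem_mSeparable hς)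
  rw [expVal_ghzDiag] at hlow
  exact hlow hb₀ (overlap_le_half_of_mem_mSeparable hς b₀)

lemma exists_mem_mSeparable_eq (h : SharpOverlapBound N D g) (hN : 2 ≤ N) {p : Index N → ℝ}
    (hp : p ∈ stdSimplex ℝ (Index N)) {b₀ : Index N} (hb₀ : 1 / 2 < p b₀) :
    ∃ q ∈ stdSimplex ℝ (Index N), q b₀ = 1 / 2 ∧ ghzDiag q ∈ mSeparable N 2 ∧
      D (ghzDiag p) (ghzDiag q) = g (p b₀) := by
  obtain ⟨r, hr, hr0, hpr⟩ := exists_eq_pointMix hp b₀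
  refine ⟨pointMix b₀ r (1 / 2),
    pointMix_mem_stdSimplex b₀ hr one_half_pos.le one_half_lt_one.le, pointMix_self hr0 _,
    ghzDiag_pointMix_half_mem_mSeparable hN hr hr0, ?_⟩
  have hattained := h.attained b₀ r hr hr0 (p b₀) hb₀ (mem_Icc_of_mem_stdSimplex hp b₀).2
  rwa [← hpr] at hattained

lemma entanglement_eq (h : SharpOverlapBound N D g) (hN : 2 ≤ N) {p : Index N → ℝ}
    (hp : p ∈ stdSimplex ℝ (Index N)) {b₀ : Index N} (hb₀ : 1 / 2 < p b₀) :
    entanglement 2 D (ghzDiag p) = g (p b₀) := by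
  have : NeZero N := ⟨by omega⟩
  obtain ⟨q, -, -, hq, hDq⟩ := h.exists_mem_mSeparable_eq hN hp hb₀
  exact le_antisymm ((entanglement_le D _ hq).trans_eq hDq)
    (le_iInf₂ fun ς hς => h.le_of_mem_mSeparable hp hb₀ hς)

lemma entanglement_eq_zero (h : SharpOverlapBound N D g) (hN : 2 ≤ N) {p : Index N → ℝ}
    (hp : p ∈ stdSimplex ℝ (Index N)) (hhalf : ∀ b, p b ≤ 1 / 2) :
    entanglement 2 D (ghzDiag p) = 0 := by
  have : NeZero N := ⟨by omega⟩
  exact le_antisymm ((entanglement_le D _ (ghzDiag_mem_mSeparable hN hp hhalf)).trans_eq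
    (h.self _ (isState_ghzDiag hp))) bot_le

lemma entanglement_ghzDiag_overlap_le (h : SharpOverlapBound N D g) (hN : 2 ≤ N) {ρ : QOp N}
    (hρ : IsState ρ) {U : Fin N → Matrix (Fin 2) (Fin 2) ℂ}
    (hU : ∀ k, U k ∈ unitaryGroup (Fin 2) ℂ) :
    entanglement 2 D (ghzDiag (overlap (localConj U ρ))) ≤ entanglement 2 D ρ := by
  have : NeZero N := ⟨by omega⟩
  have hp := overlap_mem_stdSimplex (isState_localConj hρ hU)
  obtain ⟨b₀, hb₀⟩ := Finite.exists_max (overlap (localConj U ρ))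
  rcases le_or_gt (overlap (localConj U ρ) b₀) (1 / 2) with hhalf | hhalf
  · rw [h.entanglement_eq_zero hN hp fun b => (hb₀ b).trans hhalf]
    exact bot_le
  · rw [h.entanglement_eq hN hp hhalf]
    exact h.le_entanglement hρ hU hhalf

theorem genuineLaw (h : SharpOverlapBound N D g) (hN : 2 ≤ N)
    (hmono : MonotoneOn g (Set.Ioc (1 / 2) 1))
    (hstrict : IsFaithful D → ∀ p p' : ℝ, 1 / 2 < p → p < p' → p' ≤ 1 → g p ≠ ⊤ → g p < g p') :
    GenuineLaw N D g where
  closest p hp b₀ hmax hnot := by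
    have : NeZero N := ⟨by omega⟩
    have hb₀ : 1 / 2 < p b₀ :=
      lt_of_not_ge fun hle => hnot ((ghzDiag_mem_mSeparable_iff hN hp hmax).2 hle)
    obtain ⟨q, hq, hqb₀, hqsep, hDq⟩ := h.exists_mem_mSeparable_eq hN hp hb₀
    exact ⟨q, hq, hqb₀, hqsep, fun ς hς => hDq.trans_le (h.le_of_mem_mSeparable hp hb₀ hς)⟩
  eq_zero p hp b₀ hmax hhalf := h.entanglement_eq_zero hN hp fun b => (hmax b).trans hhalf
  eq_g p hp b₀ _ hb₀ := h.entanglement_eq hN hp hb₀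
  mono := hmono
  strictMono := hstrict
  diagonalisation_le ρ hρ U hU := h.entanglement_ghzDiag_overlap_le hN hρ hU
  lower_bound ρ hρ U hU b hb := by
    have : NeZero N := ⟨by omega⟩
    exact h.le_entanglement hρ hU hb

end SharpOverlapBound

end Reduction

/-! ### Measure-and-prepare channels -/

section Channel

variable {m n : Type*} [Fintype m]

open scoped MatrixOrder in
lemma posSemidef_trace_mul_blocks {κ : Type*} [Finite κ] {E : Matrix m m ℂ}
    (hE : E.PosSemidef) {X : Matrix (κ × m) (κ × m) ℂ} (hX : X.PosSemidef) :
    (Matrix.of fun a b => (E * Matrix.of fun i j => X (a, i) (b, j)).trace).PosSemidef := by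
  classical
  cases nonempty_fintype κ
  obtain ⟨F, rfl⟩ := CStarAlgebra.nonneg_iff_eq_star_mul_self.1 hE.nonneg
  rw [star_eq_conjTranspose]
  -- The row `l` of `F`, acting on the second factor.
  let B (l : m) : Matrix κ (κ × m) ℂ := Matrix.of fun a c => if a = c.1 then F l c.2 else 0
  have hsum : (Matrix.of fun a b => (Fᴴ * F * Matrix.of fun i j => X (a, i) (b, j)).trace) =
      ∑ l, B l * X * (B l)ᴴ := by
    ext a b
    rw [Matrix.of_apply, Matrix.mul_assoc, trace_mul_comm, Matrix.sum_apply]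
    simp only [trace, diag_apply]
    refine Finset.sum_congr rfl fun l _ => ?_
    simp only [Matrix.mul_apply, B, Matrix.of_apply, conjTranspose_apply,
      Fintype.sum_prod_type, apply_ite star, star_zero, ite_mul, zero_mul, mul_ite, mul_zero,
      Finset.sum_ite_irrel, Finset.sum_const_zero, Finset.sum_ite_eq, Finset.mem_univ, if_true]
  rw [hsum]
  exact posSemidef_sum _ fun l _ => hX.mul_mul_conjTranspose_same (B l)

variable [DecidableEq m]

/-- The channel that measures the effect `E` and prepares `τ₀` or `τ₁` according to the outcome. -/
def measurePrepare (E : Matrix m m ℂ) (τ₀ τ₁ : Matrix n n ℂ) : Matrix m m ℂ →ₗ[ℂ] Matrix n n ℂ :=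
  (traceLinearMap m ℂ ℂ ∘ₗ LinearMap.mulLeft ℂ E).smulRight τ₀ +
    (traceLinearMap m ℂ ℂ ∘ₗ LinearMap.mulLeft ℂ (1 - E)).smulRight τ₁

lemma measurePrepare_apply (E X : Matrix m m ℂ) (τ₀ τ₁ : Matrix n n ℂ) :
    measurePrepare E τ₀ τ₁ X = (E * X).trace • τ₀ + ((1 - E) * X).trace • τ₁ := rfl

lemma isChannel_measurePrepare [Fintype n] {E : Matrix m m ℂ} (hE : E.PosSemidef)
    (hE' : (1 - E).PosSemidef) {τ₀ τ₁ : Matrix n n ℂ} (h₀ : IsState τ₀) (h₁ : IsState τ₁) :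
    IsChannel (measurePrepare E τ₀ τ₁) where
  completelyPositive _ _ hX :=
    ((posSemidef_trace_mul_blocks hE hX).kronecker h₀.1).add
      ((posSemidef_trace_mul_blocks hE' hX).kronecker h₁.1)
  tracePreserving X := by
    rw [measurePrepare_apply, trace_add, trace_smul, trace_smul, h₀.2, h₁.2, sub_mul, one_mul,
      trace_sub, smul_eq_mul, smul_eq_mul, mul_one, mul_one, add_sub_cancel]

lemma measurePrepare_apply_of_isState {E : Matrix m m ℂ} (hE : E.IsHermitian)
    (τ₀ τ₁ : Matrix n n ℂ) {ρ : Matrix m m ℂ} (hρ : IsState ρ) :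
    measurePrepare E τ₀ τ₁ ρ = (E * ρ).trace.re • τ₀ + (1 - (E * ρ).trace.re) • τ₁ := by
  have hreal : ((E * ρ).trace.re : ℂ) = (E * ρ).trace := by
    rw [← Complex.conj_eq_iff_re, ← Complex.star_def, ← trace_conjTranspose, conjTranspose_mul,
      hE.eq, hρ.1.isHermitian.eq, trace_mul_comm]
  rw [measurePrepare_apply, sub_mul, one_mul, trace_sub, hρ.2, ← hreal, Complex.ofReal_re,
    ← Complex.ofReal_one, ← Complex.ofReal_sub, Complex.coe_smul, Complex.coe_smul]

end Channel

/-! ### Contractive convex distances -/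

section Contractive

variable {N N' : ℕ}

lemma expVal_le_one {n : Type*} [Fintype n] {ψ : n → ℂ} (hψ : star ψ ⬝ᵥ ψ = 1)
    {ρ : Matrix n n ℂ} (hρ : IsState ρ) : expVal ψ ρ ≤ 1 := by
  classical
  have h := re_trace_mul_nonneg (posSemidef_one_sub_proj hψ) hρ.1
  rw [re_trace_one_sub_proj_mul ψ hρ] at h
  exact sub_nonneg.1 h

lemma isState_ghzDiag_pointMix [NeZero N] (c : Index N) {r : Index N → ℝ}
    (hr : r ∈ stdSimplex ℝ (Index N)) {P : ℝ} (h0 : 0 ≤ P) (h1 : P ≤ 1) :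
    IsState (ghzDiag (pointMix c r P)) :=
  isState_ghzDiag (pointMix_mem_stdSimplex c hr h0 h1)

lemma expVal_ghzDiag_pointMix [NeZero N] {c : Index N} {r : Index N → ℝ} (hr : r c = 0) (P : ℝ) :
    expVal (ghzVec c) (ghzDiag (pointMix c r P)) = P := by
  rw [expVal_ghzDiag, pointMix_self hr]

lemma pointMix_effect_le [NeZero N] {m : Type*} [Fintype m] [DecidableEq m]
    {D : QOp N → QOp N → ℝ≥0∞} {D' : Matrix m m ℂ → Matrix m m ℂ → ℝ≥0∞}
    (hle : ∀ Φ : Matrix m m ℂ →ₗ[ℂ] QOp N, IsChannel Φ →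
      ∀ ρ σ, IsState ρ → IsState σ → D (Φ ρ) (Φ σ) ≤ D' ρ σ)
    (c : Index N) {r : Index N → ℝ} (hr : r ∈ stdSimplex ℝ (Index N)) {E : Matrix m m ℂ}
    (hE : E.PosSemidef) (hE' : (1 - E).PosSemidef) {ρ σ : Matrix m m ℂ} (hρ : IsState ρ)
    (hσ : IsState σ) :
    D (ghzDiag (pointMix c r (E * ρ).trace.re)) (ghzDiag (pointMix c r (E * σ).trace.re)) ≤
      D' ρ σ := by
  have h := hle _ (isChannel_measurePrepare hE hE' (isState_proj (star_ghzVec_dotProduct_self c))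
    (isState_ghzDiag hr)) ρ σ hρ hσ
  rwa [measurePrepare_apply_of_isState hE.isHermitian _ _ hρ,
    measurePrepare_apply_of_isState hE.isHermitian _ _ hσ, ← ghzDiag_pointMix,
    ← ghzDiag_pointMix] at h

lemma pointMix_expVal_le [NeZero N] {m : Type*} [Fintype m]
    {D : QOp N → QOp N → ℝ≥0∞} {D' : Matrix m m ℂ → Matrix m m ℂ → ℝ≥0∞}
    (hle : ∀ Φ : Matrix m m ℂ →ₗ[ℂ] QOp N, IsChannel Φ →
      ∀ ρ σ, IsState ρ → IsState σ → D (Φ ρ) (Φ σ) ≤ D' ρ σ)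
    (c : Index N) {r : Index N → ℝ} (hr : r ∈ stdSimplex ℝ (Index N)) {ψ : m → ℂ}
    (hψ : star ψ ⬝ᵥ ψ = 1) {ρ σ : Matrix m m ℂ} (hρ : IsState ρ) (hσ : IsState σ) :
    D (ghzDiag (pointMix c r (expVal ψ ρ))) (ghzDiag (pointMix c r (expVal ψ σ))) ≤ D' ρ σ := by
  classical
  rw [expVal_eq_re_trace, expVal_eq_re_trace]
  exact pointMix_effect_le hle c hr (posSemidef_proj ψ) (posSemidef_one_sub_proj hψ) hρ hσ

variable [NeZero N] {D : QOp N → QOp N → ℝ≥0∞}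

lemma IsContractiveConvex.pointMix_mul_le (hD : IsContractiveConvex D) {c : Index N}
    {r : Index N → ℝ} (hr : r ∈ stdSimplex ℝ (Index N)) (hrc : r c = 0) {a P Q : ℝ}
    (ha : a ∈ Set.Icc (0 : ℝ) 1) (hP : P ∈ Set.Icc (0 : ℝ) 1) (hQ : Q ∈ Set.Icc (0 : ℝ) 1) :
    D (ghzDiag (pointMix c r (a * P))) (ghzDiag (pointMix c r (a * Q))) ≤
      D (ghzDiag (pointMix c r P)) (ghzDiag (pointMix c r Q)) := by
  have hE : (a • proj (ghzVec c)).PosSemidef := (posSemidef_proj _).smul ha.1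
  have hE' : (1 - a • proj (ghzVec c)).PosSemidef := by
    have hsplit : 1 - a • proj (ghzVec c) =
        (1 - proj (ghzVec c)) + (1 - a) • proj (ghzVec c) := by
      rw [sub_smul, one_smul, sub_add_sub_cancel]
    rw [hsplit]
    exact (posSemidef_one_sub_proj (star_ghzVec_dotProduct_self c)).add
      ((posSemidef_proj _).smul (sub_nonneg.2 ha.2))
  have htrace (x : ℝ) : (a • proj (ghzVec c) * ghzDiag (pointMix c r x)).trace.re = a * x := by
    rw [Matrix.smul_mul, trace_smul, Complex.smul_re, ← expVal_eq_re_trace,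
      expVal_ghzDiag_pointMix hrc, smul_eq_mul]
  have h := pointMix_effect_le hD.contractive c hr hE hE'
    (isState_ghzDiag_pointMix c hr hP.1 hP.2) (isState_ghzDiag_pointMix c hr hQ.1 hQ.2)
  rwa [htrace, htrace] at h

/-- The function `g_D`: the distance between GHZ-diagonal states with the weights `P` and `1/2` at
`c` and the remaining weights proportional to `r`. If `D` is contractive it does not depend on `c`
and `r`, as long as `r c = 0`. -/
def distanceToHalf (D : QOp N → QOp N → ℝ≥0∞) (c : Index N) (r : Index N → ℝ) (P : ℝ) : ℝ≥0∞ :=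
  D (ghzDiag (pointMix c r P)) (ghzDiag (pointMix c r (1 / 2)))

lemma IsContractiveConvex.distanceToHalf_le_mul (hD : IsContractiveConvex D) (c : Index N)
    {r : Index N → ℝ} (hr : r ∈ stdSimplex ℝ (Index N)) {P q : ℝ} (hP : 1 / 2 < P) (hP1 : P ≤ 1)
    (hq0 : 0 ≤ q) (hq : q ≤ 1 / 2) :
    distanceToHalf D c r P ≤ ENNReal.ofReal ((P - 1 / 2) / (P - q)) *
      D (ghzDiag (pointMix c r P)) (ghzDiag (pointMix c r q)) := by
  have hpos : 0 < P - q := by linarith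
  have hstate := isState_ghzDiag_pointMix c hr (one_half_pos.trans hP).le hP1
  have h := hD.convex _ _ _ hstate hstate (isState_ghzDiag_pointMix c hr hq0 (by linarith))
    ((1 / 2 - q) / (P - q)) (div_nonneg (by linarith) hpos.le)
    ((div_le_one hpos).2 (by linarith))
  have hweight : 1 - (1 / 2 - q) / (P - q) = (P - 1 / 2) / (P - q) := by
    field_simp
    ring
  have hmix : ((1 / 2 - q) / (P - q)) • pointMix c r P + ((P - 1 / 2) / (P - q)) • pointMix c r q =
      pointMix c r (1 / 2) := by
    funext b
    simp only [pointMix, Pi.add_apply, Pi.smul_apply, smul_eq_mul]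
    field_simp
    ring
  rwa [hweight, hD.self _ hstate, mul_zero, zero_add, ← ghzDiag_smul, ← ghzDiag_smul,
    ← ghzDiag_add, hmix] at h

lemma IsContractiveConvex.distanceToHalf_le_mul_distanceToHalf (hD : IsContractiveConvex D)
    {c : Index N} {r : Index N → ℝ} (hr : r ∈ stdSimplex ℝ (Index N)) (hrc : r c = 0) {P P' : ℝ}
    (hP : 1 / 2 < P) (hPP' : P ≤ P') (hP' : P' ≤ 1) :
    distanceToHalf D c r P ≤
      ENNReal.ofReal ((P - 1 / 2) / (P - P / P' * (1 / 2))) * distanceToHalf D c r P' := by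
  have hpos : 0 < P' := by linarith
  have hratio : P / P' ≤ 1 := (div_le_one hpos).2 hPP'
  have hratio0 : 0 ≤ P / P' := div_nonneg (by linarith) hpos.le
  have hcontract := hD.pointMix_mul_le hr hrc ⟨hratio0, hratio⟩ ⟨hpos.le, hP'⟩
    (Q := 1 / 2) (by norm_num)
  rw [div_mul_cancel₀ P hpos.ne'] at hcontract
  exact (hD.distanceToHalf_le_mul c hr hP (hPP'.trans hP') (by linarith) (by linarith)).trans
    (mul_le_mul_right hcontract _)

lemma IsContractiveConvex.monotoneOn_distanceToHalf (hD : IsContractiveConvex D) {c : Index N}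
    {r : Index N → ℝ} (hr : r ∈ stdSimplex ℝ (Index N)) (hrc : r c = 0) :
    MonotoneOn (distanceToHalf D c r) (Set.Ioc (1 / 2) 1) := by
  intro P hP P' hP' hPP'
  refine (hD.distanceToHalf_le_mul_distanceToHalf hr hrc hP.1 hPP' hP'.2).trans
    (mul_le_of_le_one_left' (ENNReal.ofReal_le_one.2 ?_))
  have hratio : P / P' ≤ 1 := (div_le_one (by linarith [hP'.1])).2 hPP'
  have hP := hP.1
  rw [div_le_one (by linarith)]
  linarith

lemma IsContractiveConvex.distanceToHalf_lt (hD : IsContractiveConvex D) {c : Index N}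
    {r : Index N → ℝ} (hr : r ∈ stdSimplex ℝ (Index N)) (hrc : r c = 0) {P P' : ℝ}
    (hP : 1 / 2 < P) (hPP' : P < P') (hP' : P' ≤ 1) (hfin : distanceToHalf D c r P ≠ ⊤)
    (hpos : distanceToHalf D c r P' ≠ 0) : distanceToHalf D c r P < distanceToHalf D c r P' := by
  rcases eq_or_ne (distanceToHalf D c r P') ⊤ with htop | htop
  · exact htop ▸ hfin.lt_top
  have hratio : P / P' < 1 := (div_lt_one (by linarith)).2 hPP'
  have hfactor : ENNReal.ofReal ((P - 1 / 2) / (P - P / P' * (1 / 2))) < 1 := by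
    rw [ENNReal.ofReal_lt_one, div_lt_one (by linarith)]
    linarith
  calc distanceToHalf D c r P
      ≤ ENNReal.ofReal ((P - 1 / 2) / (P - P / P' * (1 / 2))) * distanceToHalf D c r P' :=
        hD.distanceToHalf_le_mul_distanceToHalf hr hrc hP hPP'.le hP'
    _ < 1 * distanceToHalf D c r P' := (ENNReal.mul_lt_mul_iff_left hpos htop).2 hfactor
    _ = distanceToHalf D c r P' := one_mul _

lemma IsFaithful.distanceToHalf_ne_zero (hD : IsFaithful D) {c : Index N} {r : Index N → ℝ}
    (hr : r ∈ stdSimplex ℝ (Index N)) (hrc : r c = 0) {P : ℝ} (hP : 1 / 2 < P) (hP1 : P ≤ 1) :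
    distanceToHalf D c r P ≠ 0 := by
  intro hzero
  have heq := congrArg (expVal (ghzVec c)) (hD _ _
    (isState_ghzDiag_pointMix c hr (one_half_pos.trans hP).le hP1)
    (isState_ghzDiag_pointMix c hr one_half_pos.le one_half_lt_one.le) hzero)
  rw [expVal_ghzDiag_pointMix hrc, expVal_ghzDiag_pointMix hrc] at heq
  exact hP.ne' heq

lemma distanceToHalf_le [NeZero N'] {D' : QOp N' → QOp N' → ℝ≥0∞}
    (hle : ∀ Φ : QOp N' →ₗ[ℂ] QOp N, IsChannel Φ →
      ∀ ρ σ, IsState ρ → IsState σ → D (Φ ρ) (Φ σ) ≤ D' ρ σ)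
    (c : Index N) {r : Index N → ℝ} (hr : r ∈ stdSimplex ℝ (Index N)) {c' : Index N'}
    {r' : Index N' → ℝ} (hr' : r' ∈ stdSimplex ℝ (Index N')) (hrc' : r' c' = 0) {P : ℝ}
    (h0 : 0 ≤ P) (h1 : P ≤ 1) : distanceToHalf D c r P ≤ distanceToHalf D' c' r' P := by
  have h := pointMix_expVal_le hle c hr (star_ghzVec_dotProduct_self c')
    (isState_ghzDiag_pointMix c' hr' h0 h1)
    (isState_ghzDiag_pointMix c' hr' one_half_pos.le one_half_lt_one.le)
  rwa [expVal_ghzDiag_pointMix hrc', expVal_ghzDiag_pointMix hrc'] at h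

lemma sharpOverlapBound_distanceToHalf [NeZero N'] {D' : QOp N' → QOp N' → ℝ≥0∞}
    (hD : ∀ ρ, IsState ρ → D ρ ρ = 0) (hD' : IsContractiveConvex D')
    (hto : ∀ Φ : QOp N →ₗ[ℂ] QOp N', IsChannel Φ →
      ∀ ρ σ, IsState ρ → IsState σ → D' (Φ ρ) (Φ σ) ≤ D ρ σ)
    (hfrom : ∀ Φ : QOp N' →ₗ[ℂ] QOp N, IsChannel Φ →
      ∀ ρ σ, IsState ρ → IsState σ → D (Φ ρ) (Φ σ) ≤ D' ρ σ)
    {c : Index N'} {r : Index N' → ℝ} (hr : r ∈ stdSimplex ℝ (Index N')) (hrc : r c = 0) :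
    SharpOverlapBound N D (distanceToHalf D' c r) where
  self := hD
  lower ψ hψ ρ σ hρ hσ hPρ hPσ := by
    refine (hD'.distanceToHalf_le_mul c hr hPρ (expVal_le_one hψ hρ) (expVal_nonneg ψ hσ.1)
      hPσ).trans ((mul_le_of_le_one_left' (ENNReal.ofReal_le_one.2 ?_)).trans
        (pointMix_expVal_le hto c hr hψ hρ hσ))
    rw [div_le_one (by linarith)]
    linarith
  attained b₀ r' hr' hrb₀ P hP hP1 :=
    le_antisymm (distanceToHalf_le hfrom b₀ hr' hr hrc (one_half_pos.trans hP).le hP1)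
      (distanceToHalf_le hto c hr hr' hrb₀ (one_half_pos.trans hP).le hP1)

lemma exists_mem_stdSimplex_apply_eq_zero (N : ℕ) :
    ∃ c : Index N, ∃ r ∈ stdSimplex ℝ (Index N), r c = 0 := by
  obtain ⟨c, b, hcb⟩ := exists_pair_ne (Index N)
  exact ⟨c, Pi.single b 1, single_mem_stdSimplex ℝ b, Pi.single_eq_of_ne hcb _⟩

theorem genuineLaw_distanceToHalf [NeZero N'] (hN : 2 ≤ N) {D' : QOp N' → QOp N' → ℝ≥0∞}
    (hD : ∀ ρ, IsState ρ → D ρ ρ = 0) (hD' : IsContractiveConvex D')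
    (hto : ∀ Φ : QOp N →ₗ[ℂ] QOp N', IsChannel Φ →
      ∀ ρ σ, IsState ρ → IsState σ → D' (Φ ρ) (Φ σ) ≤ D ρ σ)
    (hfrom : ∀ Φ : QOp N' →ₗ[ℂ] QOp N, IsChannel Φ →
      ∀ ρ σ, IsState ρ → IsState σ → D (Φ ρ) (Φ σ) ≤ D' ρ σ)
    {c : Index N'} {r : Index N' → ℝ} (hr : r ∈ stdSimplex ℝ (Index N')) (hrc : r c = 0) :
    GenuineLaw N D (distanceToHalf D' c r) := by
  have hsharp := sharpOverlapBound_distanceToHalf hD hD' hto hfrom hr hrc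
  refine hsharp.genuineLaw hN (hD'.monotoneOn_distanceToHalf hr hrc)
    fun hfaithful P P' hP hPP' hP' hfin => hD'.distanceToHalf_lt hr hrc hP hPP' hP' hfin ?_
  obtain ⟨b₀, r', hr', hrb₀⟩ := exists_mem_stdSimplex_apply_eq_zero N
  rw [← hsharp.attained b₀ _ hr' hrb₀ P' (hP.trans hPP') hP']
  exact hfaithful.distanceToHalf_ne_zero hr' hrb₀ (hP.trans hPP') hP'

theorem exists_genuineLaw {N : ℕ} (hN : 2 ≤ N) {D : QOp N → QOp N → ℝ≥0∞}
    (hD : IsContractiveConvex D) : ∃ g : ℝ → ℝ≥0∞, GenuineLaw N D g := by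
  have : NeZero N := ⟨by omega⟩
  obtain ⟨c, r, hr, hrc⟩ := exists_mem_stdSimplex_apply_eq_zero N
  exact ⟨_, genuineLaw_distanceToHalf hN hD.self hD hD.contractive hD.contractive hr hrc⟩

theorem exists_genuineLaw_family {D : (N : ℕ) → QOp N → QOp N → ℝ≥0∞}
    (hD : IsContractiveConvexFamily D) :
    ∃ g : ℝ → ℝ≥0∞, ∀ N : ℕ, 2 ≤ N → GenuineLaw N (D N) g := by
  obtain ⟨c, r, hr, hrc⟩ := exists_mem_stdSimplex_apply_eq_zero 2
  refine ⟨distanceToHalf (D 2) c r, fun N hN => ?_⟩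
  have : NeZero N := ⟨by omega⟩
  exact genuineLaw_distanceToHalf hN (hD.each N).self (hD.each 2) (hD.contractive N 2)
    (hD.contractive 2 N) hr hrc

end Contractive

/-! ### Functional calculus of Hermitian matrices -/

section Calculus

variable {n : Type*} [Fintype n]

lemma re_trace_conjTranspose_mul_self_nonneg (X : Matrix n n ℂ) : 0 ≤ (Xᴴ * X).trace.re :=
  (Complex.le_def.1 (posSemidef_conjTranspose_mul_self X).trace_nonneg).1

lemma re_trace_conjTranspose_mul_le (X Y : Matrix n n ℂ) :
    (Xᴴ * Y).trace.re ≤ √(Xᴴ * X).trace.re * √(Yᴴ * Y).trace.re := by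
  have hsymm : (Yᴴ * X).trace.re = (Xᴴ * Y).trace.re := by
    rw [← conjTranspose_conjTranspose X, ← conjTranspose_mul, trace_conjTranspose,
      conjTranspose_conjTranspose, Complex.star_def, Complex.conj_re]
  have hquad (t : ℝ) : 0 ≤ (Yᴴ * Y).trace.re * (t * t) + (-2 * (Xᴴ * Y).trace.re) * t +
      (Xᴴ * X).trace.re := by
    have h := re_trace_conjTranspose_mul_self_nonneg (X - t • Y)
    simp only [conjTranspose_sub, conjTranspose_smul, star_trivial, sub_mul, mul_sub,
      Matrix.smul_mul, Matrix.mul_smul, trace_sub, trace_smul, Complex.sub_re, Complex.smul_re,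
      smul_eq_mul, hsymm] at h
    linarith
  have hdiscrim := discrim_le_zero hquad
  rw [discrim] at hdiscrim
  rw [← Real.sqrt_mul (re_trace_conjTranspose_mul_self_nonneg X)]
  exact Real.le_sqrt_of_sq_le (by linarith)

variable [DecidableEq n]

lemma cfc_mul_cfc (f g : ℝ → ℝ) (A : Matrix n n ℂ) :
    cfc f A * cfc g A = cfc (fun x => f x * g x) A :=
  (cfc_mul f g A (A.finite_real_spectrum.continuousOn _)
    (A.finite_real_spectrum.continuousOn _)).symm

lemma isHermitian_cfc (f : ℝ → ℝ) (A : Matrix n n ℂ) : (cfc f A).IsHermitian :=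
  cfc_predicate (p := IsSelfAdjoint) f A

open scoped MatrixOrder in
lemma posSemidef_cfc {f : ℝ → ℝ} (hf : ∀ x, 0 ≤ f x) (A : Matrix n n ℂ) :
    (cfc f A).PosSemidef :=
  (cfc_nonneg (a := A) fun x _ => hf x).posSemidef

open scoped MatrixOrder in
lemma cfc_congr_of_posSemidef {A : Matrix n n ℂ} (hA : A.PosSemidef) {f g : ℝ → ℝ}
    (h : ∀ x, 0 ≤ x → f x = g x) : cfc f A = cfc g A :=
  cfc_congr fun _ hx => h _ (spectrum_nonneg_of_nonneg hA.nonneg hx)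

lemma cfc_mul_self (f : ℝ → ℝ) {A : Matrix n n ℂ} (hA : A.IsHermitian) :
    cfc f A * A = cfc (fun x => f x * x) A := by
  rw [← cfc_mul_cfc, cfc_id' ℝ A hA.isSelfAdjoint]

lemma cfc_sqrt_mul_self {A : Matrix n n ℂ} (hA : A.PosSemidef) :
    cfc Real.sqrt A * cfc Real.sqrt A = A := by
  rw [cfc_mul_cfc, cfc_congr_of_posSemidef hA fun x hx => Real.mul_self_sqrt hx,
    cfc_id' ℝ A hA.1.isSelfAdjoint]

lemma cfc_inv_sqrt_mul_self {A : Matrix n n ℂ} (hA : A.IsHermitian) :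
    cfc (fun x => (√x)⁻¹) A * A = cfc Real.sqrt A := by
  simp only [cfc_mul_self _ hA, inv_mul_eq_div, Real.div_sqrt]

lemma cfc_sqrt_mul_inv_sqrt_mul_inv_sqrt (A : Matrix n n ℂ) :
    cfc Real.sqrt A * cfc (fun x => (√x)⁻¹) A * cfc (fun x => (√x)⁻¹) A =
      cfc (fun x => (√x)⁻¹) A := by
  rw [cfc_mul_cfc, cfc_mul_cfc]
  congr! 2 with x
  by_cases hx : √x = 0 <;> simp [hx]

end Calculus

/-! ### Two-outcome measurements -/

section TwoOutcome

variable {n : Type*} [Fintype n] [DecidableEq n]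

lemma two_mul_re_trace_mul_le {A E : Matrix n n ℂ} (hA : A.IsHermitian) (hE : E.PosSemidef)
    (hE' : (1 - E).PosSemidef) :
    2 * (E * A).trace.re ≤ A.trace.re + (cfc (fun x : ℝ => |x|) A).trace.re := by
  have hcont (f : ℝ → ℝ) : ContinuousOn f (spectrum ℝ A) := A.finite_real_spectrum.continuousOn f
  have hid := cfc_id' ℝ A hA.isSelfAdjoint
  have hsub : (cfc (fun x : ℝ => |x|) A - A).PosSemidef := by
    have := posSemidef_cfc (f := fun x => |x| - x) (fun x => sub_nonneg.2 (le_abs_self x)) A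
    rwa [cfc_sub (fun x => |x|) (fun x => x) A (hcont _) (hcont _), hid] at this
  have hadd : (cfc (fun x : ℝ => |x|) A + A).PosSemidef := by
    have := posSemidef_cfc (f := fun x => |x| + x)
      (fun x => by linarith [neg_abs_le x]) A
    rwa [cfc_add A (fun x => |x|) (fun x => x) (hcont _) (hcont _), hid] at this
  have h1 := re_trace_mul_nonneg hE hsub
  have h2 := re_trace_mul_nonneg hE' hadd
  simp only [mul_sub, mul_add, sub_mul, one_mul, trace_sub, trace_add, Complex.sub_re,
    Complex.add_re] at h1 h2
  linarith

lemma expVal_sub_le_trace_abs {ψ : n → ℂ} (hψ : star ψ ⬝ᵥ ψ = 1) {ρ σ : Matrix n n ℂ}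
    (hρ : IsState ρ) (hσ : IsState σ) :
    expVal ψ ρ - expVal ψ σ ≤ 1 / 2 * (cfc (fun x : ℝ => |x|) (ρ - σ)).trace.re := by
  have h := two_mul_re_trace_mul_le (hρ.1.1.sub hσ.1.1) (posSemidef_proj ψ)
    (posSemidef_one_sub_proj hψ)
  rw [← expVal_eq_re_trace, map_sub, trace_sub, hρ.2, hσ.2, sub_self, Complex.zero_re] at h
  linarith

end TwoOutcome

/-! ### Fidelity and affinity -/

section Fidelity

variable {n : Type*} [Fintype n] [DecidableEq n]

lemma re_trace_mul_mul_conjTranspose_le {W X : Matrix n n ℂ} (hW : (1 - Wᴴ * W).PosSemidef)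
    (hX : X.PosSemidef) : (W * X * Wᴴ).trace.re ≤ X.trace.re := by
  have h := re_trace_mul_nonneg hW hX
  rw [sub_mul, one_mul, trace_sub, Complex.sub_re, Matrix.mul_assoc, trace_mul_comm] at h
  linarith

open scoped MatrixOrder in
lemma re_trace_mul_mul_mul_le {W E : Matrix n n ℂ} (hW : (1 - Wᴴ * W).PosSemidef)
    (hE : E.PosSemidef) (A B : Matrix n n ℂ) :
    (W * A * E * B).trace.re ≤ √(A * E * Aᴴ).trace.re * √(Bᴴ * E * B).trace.re := by
  have hAE := re_trace_mul_mul_conjTranspose_le hW (hE.mul_mul_conjTranspose_same A)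
  obtain ⟨C, rfl⟩ := CStarAlgebra.nonneg_iff_eq_star_mul_self.1 hE.nonneg
  have h := re_trace_conjTranspose_mul_le (C * Aᴴ * Wᴴ) (C * B)
  simp only [star_eq_conjTranspose, conjTranspose_mul, conjTranspose_conjTranspose,
    Matrix.mul_assoc] at h hAE ⊢
  exact h.trans (by gcongr)

lemma trace_sqrt_mul_mul_sqrt {ρ : Matrix n n ℂ} (hρ : ρ.PosSemidef) (E : Matrix n n ℂ) :
    (cfc Real.sqrt ρ * E * cfc Real.sqrt ρ).trace = (E * ρ).trace := by
  rw [trace_mul_comm, ← Matrix.mul_assoc, cfc_sqrt_mul_self hρ, trace_mul_comm]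

lemma re_trace_mul_sqrt_mul_sqrt_le {ρ σ W E : Matrix n n ℂ} (hρ : ρ.PosSemidef)
    (hσ : σ.PosSemidef) (hW : (1 - Wᴴ * W).PosSemidef) (hE : E.PosSemidef)
    (hE' : (1 - E).PosSemidef) :
    (W * cfc Real.sqrt ρ * cfc Real.sqrt σ).trace.re ≤
      √(E * ρ).trace.re * √(E * σ).trace.re +
        √((1 - E) * ρ).trace.re * √((1 - E) * σ).trace.re := by
  have h1 := re_trace_mul_mul_mul_le hW hE (cfc Real.sqrt ρ) (cfc Real.sqrt σ)
  have h2 := re_trace_mul_mul_mul_le hW hE' (cfc Real.sqrt ρ) (cfc Real.sqrt σ)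
  rw [(isHermitian_cfc _ _).eq, (isHermitian_cfc _ _).eq, trace_sqrt_mul_mul_sqrt hρ,
    trace_sqrt_mul_mul_sqrt hσ] at h1 h2
  have hsplit : W * cfc Real.sqrt ρ * cfc Real.sqrt σ =
      W * cfc Real.sqrt ρ * E * cfc Real.sqrt σ +
        W * cfc Real.sqrt ρ * (1 - E) * cfc Real.sqrt σ := by
    rw [← add_mul, ← mul_add, add_sub_cancel, mul_one]
  rw [hsplit, trace_add, Complex.add_re]
  exact add_le_add h1 h2

lemma sqrt_mul_sqrt_add_le {P q : ℝ} (hP : 1 / 2 ≤ P) (hq : q ≤ 1 / 2) (hq0 : 0 ≤ q) :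
    √P * √q + √(1 - P) * √(1 - q) ≤ √2 / 2 * (√(1 - P) + √P) := by
  have hPle : √(1 - P) ≤ √P := Real.sqrt_le_sqrt (by linarith)
  have hqle : √q ≤ √(1 - q) := Real.sqrt_le_sqrt (by linarith)
  have hsum : √q + √(1 - q) ≤ √2 := by
    refine Real.le_sqrt_of_sq_le ?_
    nlinarith [Real.sq_sqrt hq0, Real.sq_sqrt (by linarith : 0 ≤ 1 - q),
      sq_nonneg (√q - √(1 - q))]
  -- Chebyshev's sum inequality for the oppositely ordered pairs
  have hcheb : √P * √q + √(1 - P) * √(1 - q) ≤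
      (√(1 - P) + √P) * (√q + √(1 - q)) / 2 := by
    nlinarith [mul_nonneg (sub_nonneg.2 hPle) (sub_nonneg.2 hqle)]
  calc _ ≤ (√(1 - P) + √P) * (√q + √(1 - q)) / 2 := hcheb
    _ ≤ (√(1 - P) + √P) * √2 / 2 := by gcongr
    _ = _ := by ring

lemma re_trace_mul_sqrt_mul_sqrt_le_of_expVal {ψ : n → ℂ} (hψ : star ψ ⬝ᵥ ψ = 1)
    {ρ σ W : Matrix n n ℂ} (hρ : IsState ρ) (hσ : IsState σ) (hW : (1 - Wᴴ * W).PosSemidef)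
    (hP : 1 / 2 ≤ expVal ψ ρ) (hq : expVal ψ σ ≤ 1 / 2) :
    (W * cfc Real.sqrt ρ * cfc Real.sqrt σ).trace.re ≤
      √2 / 2 * (√(1 - expVal ψ ρ) + √(expVal ψ ρ)) := by
  have h := re_trace_mul_sqrt_mul_sqrt_le hρ.1 hσ.1 hW (posSemidef_proj ψ)
    (posSemidef_one_sub_proj hψ)
  rw [re_trace_one_sub_proj_mul ψ hρ, re_trace_one_sub_proj_mul ψ hσ, ← expVal_eq_re_trace,
    ← expVal_eq_re_trace] at h
  exact h.trans (sqrt_mul_sqrt_add_le hP hq (expVal_nonneg ψ hσ.1))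

lemma posSemidef_one_sub_conjTranspose_mul_self {W : Matrix n n ℂ} (hW : W * Wᴴ * W = W) :
    (1 - Wᴴ * W).PosSemidef :=
  posSemidef_of_isStarProjection <| IsStarProjection.one_sub
    { isIdempotentElem := by
        rw [IsIdempotentElem, Matrix.mul_assoc, ← Matrix.mul_assoc W, hW]
      isSelfAdjoint := (isHermitian_conjTranspose_mul_self W).isSelfAdjoint }

-- With `T = √σ ρ √σ`, the partial isometry `W = T^{-1/2} √σ √ρ` of a polar decomposition works;
-- `T^{-1/2}` is the pseudoinverse, since `(√0)⁻¹ = 0`.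
lemma exists_rootFidelity_eq_re_trace {ρ : Matrix n n ℂ} (hρ : ρ.PosSemidef)
    (σ : Matrix n n ℂ) :
    ∃ W : Matrix n n ℂ, (1 - Wᴴ * W).PosSemidef ∧
      rootFidelity ρ σ = (W * cfc Real.sqrt ρ * cfc Real.sqrt σ).trace.re := by
  set A := cfc Real.sqrt ρ
  set B := cfc Real.sqrt σ
  set T := B * ρ * B
  set R := cfc (fun x => (√x)⁻¹) T
  have hA : Aᴴ = A := (isHermitian_cfc _ _).eq
  have hB : Bᴴ = B := (isHermitian_cfc _ _).eq
  have hR : Rᴴ = R := (isHermitian_cfc _ _).eq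
  have hT : T.IsHermitian := by
    have := (hρ.mul_mul_conjTranspose_same B).1
    rwa [hB] at this
  have hTAB : B * A * (A * B) = T := by
    rw [← Matrix.mul_assoc, Matrix.mul_assoc B, cfc_sqrt_mul_self hρ]
  have hRT : R * T = cfc Real.sqrt T := cfc_inv_sqrt_mul_self hT
  refine ⟨R * (B * A), posSemidef_one_sub_conjTranspose_mul_self ?_, ?_⟩
  · calc R * (B * A) * (R * (B * A))ᴴ * (R * (B * A))
        = R * (B * A * (A * B)) * R * R * (B * A) := by
          simp only [conjTranspose_mul, hA, hB, hR, Matrix.mul_assoc]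
      _ = R * (B * A) := by rw [hTAB, hRT, cfc_sqrt_mul_inv_sqrt_mul_inv_sqrt]
  · rw [Matrix.mul_assoc, Matrix.mul_assoc, hTAB, hRT, rootFidelity]

lemma rootFidelity_nonneg (ρ σ : Matrix n n ℂ) : 0 ≤ rootFidelity ρ σ :=
  (Complex.le_def.1 (posSemidef_cfc Real.sqrt_nonneg _).trace_nonneg).1

lemma rootFidelity_le {ψ : n → ℂ} (hψ : star ψ ⬝ᵥ ψ = 1) {ρ σ : Matrix n n ℂ}
    (hρ : IsState ρ) (hσ : IsState σ) (hP : 1 / 2 ≤ expVal ψ ρ) (hq : expVal ψ σ ≤ 1 / 2) :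
    rootFidelity ρ σ ≤ √2 / 2 * (√(1 - expVal ψ ρ) + √(expVal ψ ρ)) := by
  obtain ⟨W, hW, hfid⟩ := exists_rootFidelity_eq_re_trace hρ.1 σ
  exact hfid ▸ re_trace_mul_sqrt_mul_sqrt_le_of_expVal hψ hρ hσ hW hP hq

lemma affinity_le {ψ : n → ℂ} (hψ : star ψ ⬝ᵥ ψ = 1) {ρ σ : Matrix n n ℂ}
    (hρ : IsState ρ) (hσ : IsState σ) (hP : 1 / 2 ≤ expVal ψ ρ) (hq : expVal ψ σ ≤ 1 / 2) :
    (cfc Real.sqrt ρ * cfc Real.sqrt σ).trace.re ≤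
      √2 / 2 * (√(1 - expVal ψ ρ) + √(expVal ψ ρ)) := by
  simpa using re_trace_mul_sqrt_mul_sqrt_le_of_expVal (W := 1) hψ hρ hσ
    (by simpa using PosSemidef.zero) hP hq

end Fidelity

/-! ### Weighted logarithms -/

section Logarithms

variable {ι κ : Type*} [Fintype ι] [Fintype κ]

/-- The logarithms of the points `(1 - u) s + u r` of a segment, summed with the weights `a`. Terms
of weight `0` are harmless whatever the sign of `s` and `r`. -/
def segmentLog (a s r : ι → ℝ) (u : ℝ) : ℝ :=
  ∑ t, a t * Real.log ((1 - u) * s t + u * r t)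

/-- The resolvents `r / ((1 - u) s + u r)` summed with the weights `a`; up to an additive constant,
`1 - u` times the derivative of `segmentLog`. -/
def segmentResolvent (a s r : ι → ℝ) (u : ℝ) : ℝ :=
  ∑ t, a t * (r t / ((1 - u) * s t + u * r t))

lemma segment_pos {s r u : ℝ} (hs : 0 < s) (hr : 0 < r) (hu : u ∈ Set.Icc (0 : ℝ) 1) :
    0 < (1 - u) * s + u * r :=
  convex_Ioi (0 : ℝ) hs hr (sub_nonneg.2 hu.2) hu.1 (sub_add_cancel 1 u)

lemma hasDerivAt_segmentLog {a s r : ι → ℝ} (hpos : ∀ t, a t ≠ 0 → 0 < s t ∧ 0 < r t) {u : ℝ}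
    (hu : u ∈ Set.Icc (0 : ℝ) 1) :
    HasDerivAt (segmentLog a s r) (∑ t, a t * ((r t - s t) / ((1 - u) * s t + u * r t))) u := by
  refine HasDerivAt.fun_sum fun t _ => ?_
  by_cases ha : a t = 0
  · simpa [ha] using hasDerivAt_const u (0 : ℝ)
  · have hseg : HasDerivAt (fun u : ℝ => (1 - u) * s t + u * r t) (r t - s t) u :=
      ((((hasDerivAt_id' u).const_sub 1).mul_const (s t)).add
        ((hasDerivAt_id' u).mul_const (r t))).congr_deriv (by ring)
    exact (hseg.log (segment_pos (hpos t ha).1 (hpos t ha).2 hu).ne').const_mul (a t)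

lemma one_sub_mul_sum_deriv {a s r : ι → ℝ} (hpos : ∀ t, a t ≠ 0 → 0 < s t ∧ 0 < r t) {u : ℝ}
    (hu : u ∈ Set.Icc (0 : ℝ) 1) :
    (1 - u) * ∑ t, a t * ((r t - s t) / ((1 - u) * s t + u * r t)) =
      segmentResolvent a s r u - ∑ t, a t := by
  rw [segmentResolvent, Finset.mul_sum, ← Finset.sum_sub_distrib]
  refine Finset.sum_congr rfl fun t _ => ?_
  by_cases ha : a t = 0
  · simp [ha]
  · have := (segment_pos (hpos t ha).1 (hpos t ha).2 hu).ne'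
    field_simp
    ring

lemma sum_mul_log_sub_log_le {a s r : ι → ℝ} {b s' r' : κ → ℝ}
    (ha : ∀ t, a t ≠ 0 → 0 < s t ∧ 0 < r t) (hb : ∀ t, b t ≠ 0 → 0 < s' t ∧ 0 < r' t)
    (hsum : ∑ t, b t = ∑ t, a t)
    (hle : ∀ u ∈ Set.Ioo (0 : ℝ) 1, segmentResolvent b s' r' u ≤ segmentResolvent a s r u) :
    ∑ t, b t * (Real.log (r' t) - Real.log (s' t)) ≤
      ∑ t, a t * (Real.log (r t) - Real.log (s t)) := by
  have hderiv (u : ℝ) (hu : u ∈ Set.Icc (0 : ℝ) 1) :=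
    (hasDerivAt_segmentLog ha hu).sub (hasDerivAt_segmentLog hb hu)
  have hmono : MonotoneOn (segmentLog a s r - segmentLog b s' r') (Set.Icc 0 1) := by
    refine monotoneOn_of_deriv_nonneg (convex_Icc 0 1)
      (fun u hu => (hderiv u hu).continuousAt.continuousWithinAt)
      (fun u hu => (hderiv u (interior_subset hu)).differentiableAt.differentiableWithinAt)
      fun u hu => ?_
    rw [(hderiv u (interior_subset hu)).deriv]
    rw [interior_Icc] at hu
    have hu' := Set.Ioo_subset_Icc_self hu
    refine nonneg_of_mul_nonneg_right (a := 1 - u) ?_ (sub_pos.2 hu.2)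
    rw [mul_sub, one_sub_mul_sum_deriv ha hu', one_sub_mul_sum_deriv hb hu']
    linarith [hle u hu]
  have h := hmono (Set.left_mem_Icc.2 zero_le_one) (Set.right_mem_Icc.2 zero_le_one) zero_le_one
  simp only [Pi.sub_apply, segmentLog, sub_zero, one_mul, zero_mul, add_zero, sub_self,
    zero_add] at h
  simp only [mul_sub, Finset.sum_sub_distrib]
  linarith

lemma gRE_mul_log_two (P : ℝ) :
    gRE P * Real.log 2 = ∑ t, ![P, 1 - P] t * (Real.log (![P, 1 - P] t) - Real.log (1 / 2)) := by
  have := (Real.log_pos one_lt_two).ne'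
  simp only [gRE, Real.logb, Fin.sum_univ_two, cons_val_zero, cons_val_one, one_div,
    Real.log_inv]
  field_simp
  ring

-- For `q = 1/2` this is the maximum over `x` and `y`, attained at the two resolvents; since
-- `x ≥ y` there, the right-hand side only grows when `q` decreases.
lemma exists_segmentResolvent_le {P q u : ℝ} (hP : 1 / 2 ≤ P) (hP1 : P ≤ 1) (hq : q ≤ 1 / 2)
    (hu : u ∈ Set.Ioo (0 : ℝ) 1) :
    ∃ x y : ℝ, segmentResolvent ![P, 1 - P] (fun _ => 1 / 2) ![P, 1 - P] u ≤
      2 * (x * P + y * (1 - P)) - (1 - u) * (x ^ 2 * q + y ^ 2 * (1 - q)) -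
        u * (x ^ 2 * P + y ^ 2 * (1 - P)) := by
  have h1u : 0 < 1 - u := sub_pos.2 hu.2
  have hm : 0 < (1 - u) * (1 / 2) + u * P := by nlinarith [hu.1]
  have hm' : 0 < (1 - u) * (1 / 2) + u * (1 - P) := by nlinarith [hu.1]
  refine ⟨P / ((1 - u) * (1 / 2) + u * P), (1 - P) / ((1 - u) * (1 / 2) + u * (1 - P)), ?_⟩
  simp only [segmentResolvent, Fin.sum_univ_two, cons_val_zero, cons_val_one]
  set m := (1 - u) * (1 / 2) + u * P with hm_def
  set m' := (1 - u) * (1 / 2) + u * (1 - P) with hm'_def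
  have hx : P / m * m = P := div_mul_cancel₀ _ hm.ne'
  have hy : (1 - P) / m' * m' = 1 - P := div_mul_cancel₀ _ hm'.ne'
  have hyx : (1 - P) / m' ≤ P / m := by
    rw [div_le_div_iff₀ hm' hm, hm_def, hm'_def]
    nlinarith
  have hy0 : 0 ≤ (1 - P) / m' := div_nonneg (by linarith) hm'.le
  set x := P / m
  set y := (1 - P) / m'
  have hgap : 0 ≤ (1 - u) * ((1 / 2 - q) * (x ^ 2 - y ^ 2)) :=
    mul_nonneg h1u.le (mul_nonneg (by linarith) (by nlinarith))
  calc P * x + (1 - P) * y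
      ≤ P * x + (1 - P) * y + (1 - u) * ((1 / 2 - q) * (x ^ 2 - y ^ 2)) := by linarith
    _ = 2 * (x * P + y * (1 - P)) - x * (x * m) - y * (y * m') +
          (1 - u) * ((1 / 2 - q) * (x ^ 2 - y ^ 2)) := by rw [hx, hy]; ring
    _ = _ := by rw [hm_def, hm'_def]; ring

end Logarithms

/-! ### Relative entropy -/

section RelativeEntropy

variable {n : Type*} [Fintype n] [DecidableEq n] {A B : Matrix n n ℂ}

/-- The matrix elements `⟨f_j|X|e_i⟩` of `X` between the eigenvectors `e_i` of `A`, labelling the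
columns, and `f_j` of `B`, labelling the rows. -/
def eigenElement (hA : A.IsHermitian) (hB : B.IsHermitian) (X : Matrix n n ℂ) : Matrix n n ℂ :=
  (hB.eigenvectorUnitary : Matrix n n ℂ)ᴴ * X * (hA.eigenvectorUnitary : Matrix n n ℂ)

lemma cfc_eq_mul_diagonal_mul (hA : A.IsHermitian) (f : ℝ → ℝ) :
    cfc f A = (hA.eigenvectorUnitary : Matrix n n ℂ) *
      diagonal (fun i => (f (hA.eigenvalues i) : ℂ)) *
        (hA.eigenvectorUnitary : Matrix n n ℂ)ᴴ := by
  rw [hA.cfc_eq, IsHermitian.cfc, Unitary.conjStarAlgAut_apply]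
  rfl

lemma trace_diagonal_mul_mul_diagonal_mul {m R : Type*} [Fintype m] [DecidableEq m]
    [CommSemiring R] (a : n → R) (b : m → R) (X : Matrix n m R) (Y : Matrix m n R) :
    (diagonal a * X * diagonal b * Y).trace =
      ∑ t : n × m, a t.1 * b t.2 * (X t.1 t.2 * Y t.2 t.1) := by
  rw [Fintype.sum_prod_type, trace]
  refine Finset.sum_congr rfl fun i _ => ?_
  rw [diag_apply, Matrix.mul_apply]
  refine Finset.sum_congr rfl fun j _ => ?_
  rw [mul_diagonal, diagonal_mul]
  ring

lemma trace_cfc_mul_mul_cfc_mul (hA : A.IsHermitian) (hB : B.IsHermitian) (f g : ℝ → ℝ)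
    (X Y : Matrix n n ℂ) :
    (cfc f A * Xᴴ * cfc g B * Y).trace =
      ∑ t : n × n, (f (hA.eigenvalues t.1) : ℂ) * (g (hB.eigenvalues t.2) : ℂ) *
        (star (eigenElement hA hB X t.2 t.1) * eigenElement hA hB Y t.2 t.1) := by
  have h := trace_diagonal_mul_mul_diagonal_mul (fun i => (f (hA.eigenvalues i) : ℂ))
    (fun j => (g (hB.eigenvalues j) : ℂ)) (eigenElement hA hB X)ᴴ (eigenElement hA hB Y)
  simp only [conjTranspose_apply] at h
  rw [← h, cfc_eq_mul_diagonal_mul hA, cfc_eq_mul_diagonal_mul hB]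
  simp only [eigenElement, conjTranspose_mul, conjTranspose_conjTranspose, Matrix.mul_assoc]
  rw [trace_mul_comm]
  simp only [Matrix.mul_assoc]

lemma re_trace_cfc_mul_conjTranspose_mul_cfc_mul (hA : A.IsHermitian) (hB : B.IsHermitian)
    (f g : ℝ → ℝ) (X : Matrix n n ℂ) :
    (cfc f A * Xᴴ * cfc g B * X).trace.re =
      ∑ t : n × n, f (hA.eigenvalues t.1) * g (hB.eigenvalues t.2) *
        ‖eigenElement hA hB X t.2 t.1‖ ^ 2 := by
  rw [trace_cfc_mul_mul_cfc_mul hA hB]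
  simp_rw [Complex.star_def, Complex.conj_mul']
  exact_mod_cast rfl

lemma re_trace_cfc_mul_cfc (hA : A.IsHermitian) (hB : B.IsHermitian) (f g : ℝ → ℝ) :
    (cfc f A * cfc g B).trace.re =
      ∑ t : n × n, f (hA.eigenvalues t.1) * g (hB.eigenvalues t.2) *
        ‖eigenElement hA hB 1 t.2 t.1‖ ^ 2 := by
  simpa using re_trace_cfc_mul_conjTranspose_mul_cfc_mul hA hB f g 1

lemma re_trace_cfc_mul (hA : A.IsHermitian) (hB : B.IsHermitian) (f : ℝ → ℝ)
    (X : Matrix n n ℂ) :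
    (cfc f A * X).trace.re =
      ∑ t : n × n, f (hA.eigenvalues t.1) *
        (star (eigenElement hA hB 1 t.2 t.1) * eigenElement hA hB X t.2 t.1).re := by
  have h := trace_cfc_mul_mul_cfc_mul hA hB f (fun _ => 1) 1 X
  rw [cfc_const_one ℝ B hB.isSelfAdjoint, conjTranspose_one, mul_one, mul_one] at h
  rw [h, Complex.re_sum]
  refine Finset.sum_congr rfl fun t _ => ?_
  rw [Complex.ofReal_one, mul_one, Complex.re_ofReal_mul]

/-- The weights `a_i |⟨f_j|e_i⟩|²`, with `a_i` the eigenvalue of `A` for `e_i`: the first of the two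
Nussbaum–Szkoła distributions of a pair of states, whose classical relative entropy is the quantum
one. -/
def nussbaumSzkola (hA : A.IsHermitian) (hB : B.IsHermitian) (t : n × n) : ℝ :=
  hA.eigenvalues t.1 * ‖eigenElement hA hB 1 t.2 t.1‖ ^ 2

lemma sum_nussbaumSzkola (hA : A.IsHermitian) (hB : B.IsHermitian) :
    ∑ t, nussbaumSzkola hA hB t = A.trace.re := by
  have h := re_trace_cfc_mul_cfc hA hB (fun x => x) fun _ => 1
  rw [cfc_id' ℝ A hA.isSelfAdjoint, cfc_const_one ℝ B hB.isSelfAdjoint, mul_one] at h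
  simp only [h, nussbaumSzkola, mul_one]

lemma re_trace_mul_logb_sub_logb (hA : A.IsHermitian) (hB : B.IsHermitian) :
    (A * (cfc (Real.logb 2) A - cfc (Real.logb 2) B)).trace.re * Real.log 2 =
      ∑ t, nussbaumSzkola hA hB t *
        (Real.log (hA.eigenvalues t.1) - Real.log (hB.eigenvalues t.2)) := by
  have hsame := re_trace_cfc_mul_cfc hA hB (fun x => x * Real.logb 2 x) fun _ => 1
  have hcross := re_trace_cfc_mul_cfc hA hB (fun x => x) (Real.logb 2)
  rw [← cfc_mul_cfc, cfc_const_one ℝ B hB.isSelfAdjoint, mul_one,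
    cfc_id' ℝ A hA.isSelfAdjoint] at hsame
  rw [cfc_id' ℝ A hA.isSelfAdjoint] at hcross
  rw [mul_sub, trace_sub, Complex.sub_re, hsame, hcross, ← Finset.sum_sub_distrib, Finset.sum_mul]
  have := (Real.log_pos one_lt_two).ne'
  refine Finset.sum_congr rfl fun t _ => ?_
  simp only [nussbaumSzkola, Real.logb]
  field_simp

lemma mul_eq_zero_of_ker_le {m R : Type*} [Fintype m] [NonUnitalSemiring R] {A B P : Matrix m m R}
    (hker : ∀ v : m → R, B *ᵥ v = 0 → A *ᵥ v = 0) (hBP : B * P = 0) : A * P = 0 := by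
  ext i j
  have h := hker (P.col j) (funext fun k => congrFun (congrFun hBP k) j)
  exact congrFun h i

lemma eigenvalues_pos_of_nussbaumSzkola_ne_zero (hA : A.PosSemidef) (hB : B.PosSemidef)
    (hker : ∀ v : n → ℂ, B *ᵥ v = 0 → A *ᵥ v = 0) (t : n × n)
    (ht : nussbaumSzkola hA.1 hB.1 t ≠ 0) :
    0 < hB.1.eigenvalues t.2 ∧ 0 < hA.1.eigenvalues t.1 := by
  refine ⟨(hB.eigenvalues_nonneg _).lt_of_ne fun h0 => ht ?_,
    (hA.eigenvalues_nonneg _).lt_of_ne' (left_ne_zero_of_mul ht)⟩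
  -- `P` is the projection onto the kernel of `B`
  set P := cfc (fun x : ℝ => if x = 0 then (1 : ℝ) else 0) B
  have hBP : B * P = 0 := by
    have hzero (x : ℝ) : x * (if x = 0 then 1 else 0) = 0 := by
      split_ifs with hx <;> simp [hx]
    have h := cfc_mul_cfc (fun x => x) (fun x => if x = 0 then 1 else 0) B
    rwa [funext hzero, cfc_id' ℝ B hB.1.isSelfAdjoint, cfc_const_zero] at h
  have hsum := re_trace_cfc_mul_cfc hA.1 hB.1 (fun x => x) fun x => if x = 0 then 1 else 0
  rw [cfc_id' ℝ A hA.1.isSelfAdjoint, mul_eq_zero_of_ker_le hker hBP, trace_zero,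
    Complex.zero_re, eq_comm, Finset.sum_eq_zero_iff_of_nonneg] at hsum
  · simpa [← h0, nussbaumSzkola] using hsum t (Finset.mem_univ t)
  · intro t _
    have := hA.eigenvalues_nonneg t.1
    positivity

lemma two_mul_re_sub_le {c r : ℝ} (hc : 0 ≤ c) (hr : 0 ≤ r) (hrc : c = 0 → r = 0) (z w : ℂ) :
    2 * (r * (star z * w).re) - c * ‖w‖ ^ 2 ≤ r * ‖z‖ ^ 2 * (r / c) := by
  rcases hc.eq_or_lt with rfl | hc
  · simp [hrc rfl]
  · have hre : r * (star z * w).re ≤ r * (‖z‖ * ‖w‖) := by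
      gcongr
      simpa using Complex.re_le_norm (star z * w)
    rw [mul_div_assoc', le_div_iff₀ hc]
    nlinarith [sq_nonneg (r * ‖z‖ - c * ‖w‖)]

lemma two_mul_re_trace_sub_le_segmentResolvent (hA : A.PosSemidef) (hB : B.PosSemidef)
    (X : Matrix n n ℂ) {u : ℝ} (hu : u ∈ Set.Ioo (0 : ℝ) 1) :
    2 * (A * X).trace.re - (1 - u) * (Xᴴ * B * X).trace.re - u * (A * Xᴴ * X).trace.re ≤
      segmentResolvent (nussbaumSzkola hA.1 hB.1) (fun t => hB.1.eigenvalues t.2)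
        (fun t => hA.1.eigenvalues t.1) u := by
  have hX := re_trace_cfc_mul hA.1 hB.1 (fun x => x) X
  have hBX := re_trace_cfc_mul_conjTranspose_mul_cfc_mul hA.1 hB.1 (fun _ => 1) (fun x => x) X
  have hAX := re_trace_cfc_mul_conjTranspose_mul_cfc_mul hA.1 hB.1 (fun x => x) (fun _ => 1) X
  simp only [cfc_id' ℝ A hA.1.isSelfAdjoint, cfc_id' ℝ B hB.1.isSelfAdjoint,
    cfc_const_one ℝ A hA.1.isSelfAdjoint, cfc_const_one ℝ B hB.1.isSelfAdjoint, one_mul,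
    mul_one] at hX hBX hAX
  rw [hX, hBX, hAX, segmentResolvent, Finset.mul_sum, Finset.mul_sum, Finset.mul_sum,
    ← Finset.sum_sub_distrib, ← Finset.sum_sub_distrib]
  refine Finset.sum_le_sum fun t _ => ?_
  have ha : 0 ≤ hA.1.eigenvalues t.1 := hA.eigenvalues_nonneg _
  have hb : 0 ≤ (1 - u) * hB.1.eigenvalues t.2 :=
    mul_nonneg (sub_nonneg.2 hu.2.le) (hB.eigenvalues_nonneg _)
  refine le_of_eq_of_le ?_ (two_mul_re_sub_le (add_nonneg hb (mul_nonneg hu.1.le ha)) ha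
    (fun h0 => ?_) (eigenElement hA.1 hB.1 1 t.2 t.1) (eigenElement hA.1 hB.1 X t.2 t.1))
  · ring
  · nlinarith [hu.1]

lemma re_trace_smul_proj_add_mul (ψ : n → ℂ) {ρ : Matrix n n ℂ} (hρ : IsState ρ) (x y : ℝ) :
    ((x • proj ψ + y • (1 - proj ψ)) * ρ).trace.re =
      x * expVal ψ ρ + y * (1 - expVal ψ ρ) := by
  rw [add_mul, Matrix.smul_mul, Matrix.smul_mul, trace_add, trace_smul, trace_smul, Complex.add_re,
    Complex.smul_re, Complex.smul_re, re_trace_one_sub_proj_mul ψ hρ, ← expVal_eq_re_trace,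
    smul_eq_mul, smul_eq_mul]

lemma smul_add_smul_one_sub_mul_self {R : Type*} [Ring R] [Algebra ℝ R] {E : R}
    (hE : IsIdempotentElem E) (x y : ℝ) :
    (x • E + y • (1 - E)) * (x • E + y • (1 - E)) = x ^ 2 • E + y ^ 2 • (1 - E) := by
  simp only [add_mul, mul_add, smul_mul_smul_comm, hE.eq, hE.mul_one_sub_self,
    hE.one_sub_mul_self, hE.one_sub.eq, smul_zero, add_zero, zero_add, sq]

lemma gRE_le_relativeEntropy {ψ : n → ℂ} (hψ : star ψ ⬝ᵥ ψ = 1) {ρ σ : Matrix n n ℂ}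
    (hρ : IsState ρ) (hσ : IsState σ) (hP : 1 / 2 ≤ expVal ψ ρ) (hq : expVal ψ σ ≤ 1 / 2)
    (hker : ∀ v : n → ℂ, σ *ᵥ v = 0 → ρ *ᵥ v = 0) :
    gRE (expVal ψ ρ) ≤ (ρ * (cfc (Real.logb 2) ρ - cfc (Real.logb 2) σ)).trace.re := by
  have hP1 := expVal_le_one hψ hρ
  refine le_of_mul_le_mul_right ?_ (Real.log_pos one_lt_two)
  rw [gRE_mul_log_two, re_trace_mul_logb_sub_logb hρ.1.1 hσ.1.1]
  refine sum_mul_log_sub_log_le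
    (eigenvalues_pos_of_nussbaumSzkola_ne_zero hρ.1 hσ.1 hker) (fun t ht => ⟨by norm_num, ?_⟩) ?_
    fun u hu => ?_
  · refine lt_of_le_of_ne ?_ ht.symm
    fin_cases t
    · exact expVal_nonneg ψ hρ.1
    · exact sub_nonneg.2 hP1
  · rw [sum_nussbaumSzkola, hρ.2]
    simp
  · obtain ⟨x, y, hxy⟩ := exists_segmentResolvent_le hP hP1 hq hu
    set X := x • proj ψ + y • (1 - proj ψ) with hX
    have hXh : Xᴴ = X := by
      simp [hX, (posSemidef_proj ψ).1.eq]
    have hXX : X * X = x ^ 2 • proj ψ + y ^ 2 • (1 - proj ψ) :=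
      smul_add_smul_one_sub_mul_self (isStarProjection_proj hψ).isIdempotentElem x y
    have h := two_mul_re_trace_sub_le_segmentResolvent hρ.1 hσ.1 X hu
    have hρX : (ρ * X).trace.re = x * expVal ψ ρ + y * (1 - expVal ψ ρ) := by
      rw [trace_mul_comm, hX, re_trace_smul_proj_add_mul ψ hρ]
    have hσXX : (X * σ * X).trace.re = x ^ 2 * expVal ψ σ + y ^ 2 * (1 - expVal ψ σ) := by
      rw [trace_mul_comm, ← Matrix.mul_assoc, hXX, re_trace_smul_proj_add_mul ψ hσ]
    have hρXX : (ρ * X * X).trace.re = x ^ 2 * expVal ψ ρ + y ^ 2 * (1 - expVal ψ ρ) := by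
      rw [Matrix.mul_assoc, trace_mul_comm, hXX, re_trace_smul_proj_add_mul ψ hρ]
    rw [hXh, hρX, hσXX, hρXX] at h
    exact hxy.trans h

end RelativeEntropy

/-! ### Standard distances between GHZ-diagonal states -/

section Diagonal

variable {N : ℕ} [NeZero N]

/-- `ghzDiag` as an algebra homomorphism, which lets polynomials, and hence the functional calculus,
act on the eigenvalues. -/
def ghzDiagHom : (Index N → ℝ) →ₐ[ℝ] QOp N :=
  AlgHom.ofLinearMap ⟨⟨ghzDiag, ghzDiag_add⟩, ghzDiag_smul⟩ ghzDiag_one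
    fun p q => (ghzDiag_mul p q).symm

lemma aeval_ghzDiag (Q : Polynomial ℝ) (p : Index N → ℝ) :
    Polynomial.aeval (ghzDiag p) Q = ghzDiag fun b => Q.eval (p b) := by
  have hcoord (b : Index N) : Q.eval (p b) = Polynomial.aeval p Q b := by
    rw [← Polynomial.coe_aeval_eq_eval]
    exact Polynomial.aeval_algHom_apply (Pi.evalAlgHom ℝ (fun _ : Index N => ℝ) b) p Q
  rw [funext hcoord]
  exact Polynomial.aeval_algHom_apply ghzDiagHom p Q

lemma cfc_ghzDiag (f : ℝ → ℝ) (p : Index N → ℝ) :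
    cfc f (ghzDiag p) = ghzDiag fun b => f (p b) := by
  -- the interpolation nodes also contain the `p b`, so that these need not be identified with the
  -- points of the spectrum
  let S : Finset ℝ := (ghzDiag p).finite_real_spectrum.toFinset ∪ Finset.univ.image p
  let Q := Lagrange.interpolate S id f
  have heval : ∀ x ∈ S, Q.eval x = f x := fun x hx =>
    Lagrange.eval_interpolate_at_node f Function.injective_id.injOn hx
  have hspec : (spectrum ℝ (ghzDiag p)).EqOn f Q.eval := fun x hx =>
    (heval x (by simp [S, hx])).symm
  have hp (b : Index N) : Q.eval (p b) = f (p b) := heval _ (by simp [S])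
  rw [cfc_congr hspec, cfc_polynomial Q _ (ghzDiag_isHermitian p).isSelfAdjoint, aeval_ghzDiag]
  simp only [hp]

lemma re_trace_ghzDiag (p : Index N → ℝ) : (ghzDiag p).trace.re = ∑ b, p b := by
  rw [trace_ghzDiag, Complex.ofReal_re]

lemma trace_abs_ghzDiag_sub (p q : Index N → ℝ) :
    (cfc (fun x : ℝ => |x|) (ghzDiag p - ghzDiag q)).trace.re = ∑ b, |p b - q b| := by
  rw [← ghzDiag_sub, cfc_ghzDiag, re_trace_ghzDiag]
  rfl

lemma affinity_ghzDiag (p q : Index N → ℝ) :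
    (cfc Real.sqrt (ghzDiag p) * cfc Real.sqrt (ghzDiag q)).trace.re = ∑ b, √(p b) * √(q b) := by
  rw [cfc_ghzDiag, cfc_ghzDiag, ghzDiag_mul, re_trace_ghzDiag]
  rfl

lemma rootFidelity_ghzDiag (p : Index N → ℝ) {q : Index N → ℝ} (hq : ∀ b, 0 ≤ q b) :
    rootFidelity (ghzDiag p) (ghzDiag q) = ∑ b, √(p b) * √(q b) := by
  rw [rootFidelity, cfc_ghzDiag, ghzDiag_mul, ghzDiag_mul, cfc_ghzDiag, re_trace_ghzDiag]
  refine Finset.sum_congr rfl fun b _ => ?_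
  simp only [Pi.mul_apply]
  rw [mul_right_comm, Real.mul_self_sqrt (hq b), mul_comm, Real.sqrt_mul' _ (hq b)]

lemma relativeEntropy_ghzDiag (p q : Index N → ℝ) :
    (ghzDiag p * (cfc (Real.logb 2) (ghzDiag p) - cfc (Real.logb 2) (ghzDiag q))).trace.re =
      ∑ b, p b * (Real.logb 2 (p b) - Real.logb 2 (q b)) := by
  rw [cfc_ghzDiag, cfc_ghzDiag, ← ghzDiag_sub, ghzDiag_mul, re_trace_ghzDiag]
  rfl

lemma ghzDiag_mulVec_eq_zero {p q : Index N → ℝ} (h : ∀ b, q b = 0 → p b = 0) {v : Bits N → ℂ}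
    (hv : ghzDiag q *ᵥ v = 0) : ghzDiag p *ᵥ v = 0 := by
  have hfactor : p = (fun b => p b / q b) * q :=
    funext fun b => (div_mul_cancel_of_imp (h b)).symm
  rw [hfactor, ← ghzDiag_mul, ← mulVec_mulVec, hv, mulVec_zero]

end Diagonal

lemma pointMix_eq_zero_of_half {ι : Type*} [DecidableEq ι] {r : ι → ℝ} {b₀ : ι} (hr0 : r b₀ = 0)
    (P : ℝ) {b : ι} (hb : pointMix b₀ r (1 / 2) b = 0) : pointMix b₀ r P b = 0 := by
  rcases eq_or_ne b b₀ with rfl | hne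
  · rw [pointMix_self hr0] at hb
    norm_num at hb
  · rw [pointMix_of_ne hne] at hb ⊢
    rw [(mul_eq_zero.1 hb).resolve_left (by norm_num), mul_zero]

section PointMixSums

variable {ι : Type*} [Fintype ι] {r : ι → ℝ} {b₀ : ι}

lemma sum_eq_of_off_point {h : ι → ℝ} (hr : r ∈ stdSimplex ℝ ι) (hr0 : r b₀ = 0) {y : ℝ}
    (hy : ∀ b, b ≠ b₀ → h b = y * r b) : ∑ b, h b = h b₀ + y := by
  classical
  have hsum : ∑ b ∈ {b₀}ᶜ, r b = 1 := by
    rw [← hr.2, ← Finset.sum_add_sum_compl {b₀} r, Finset.sum_singleton, hr0, zero_add]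
  rw [← Finset.sum_add_sum_compl {b₀} h, Finset.sum_singleton,
    Finset.sum_congr rfl fun b hb => hy b (by simpa using hb), ← Finset.mul_sum, hsum, mul_one]

variable [DecidableEq ι]

lemma sum_abs_pointMix_sub (hr : r ∈ stdSimplex ℝ ι) (hr0 : r b₀ = 0) (P Q : ℝ) :
    ∑ b, |pointMix b₀ r P b - pointMix b₀ r Q b| = 2 * |P - Q| := by
  rw [sum_eq_of_off_point hr hr0 (y := |P - Q|) fun b hb => ?_, pointMix_self hr0,
    pointMix_self hr0, two_mul]
  rw [pointMix_of_ne hb, pointMix_of_ne hb, ← sub_mul, abs_mul, abs_of_nonneg (hr.1 b),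
    sub_sub_sub_cancel_left, abs_sub_comm]

lemma sum_sqrt_mul_sqrt_pointMix (hr : r ∈ stdSimplex ℝ ι) (hr0 : r b₀ = 0) {P Q : ℝ}
    (hP : P ≤ 1) (hQ : Q ≤ 1) :
    ∑ b, √(pointMix b₀ r P b) * √(pointMix b₀ r Q b) = √P * √Q + √(1 - P) * √(1 - Q) := by
  rw [sum_eq_of_off_point hr hr0 (y := √(1 - P) * √(1 - Q)) fun b hb => ?_, pointMix_self hr0,
    pointMix_self hr0]
  rw [pointMix_of_ne hb, pointMix_of_ne hb, Real.sqrt_mul (sub_nonneg.2 hP),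
    Real.sqrt_mul (sub_nonneg.2 hQ), mul_mul_mul_comm, Real.mul_self_sqrt (hr.1 b)]

lemma sum_sqrt_mul_sqrt_pointMix_half (hr : r ∈ stdSimplex ℝ ι) (hr0 : r b₀ = 0) {P : ℝ}
    (hP : P ≤ 1) :
    ∑ b, √(pointMix b₀ r P b) * √(pointMix b₀ r (1 / 2) b) = √2 / 2 * (√(1 - P) + √P) := by
  have hhalf : √(1 / 2) = √2 / 2 := by
    rw [Real.sqrt_div zero_le_one, Real.sqrt_one, Real.sqrt_div_self']
  rw [sum_sqrt_mul_sqrt_pointMix hr hr0 hP one_half_lt_one.le, sub_half, hhalf]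
  ring

lemma sum_mul_logb_sub_logb_pointMix_half (hr : r ∈ stdSimplex ℝ ι) (hr0 : r b₀ = 0) (P : ℝ) :
    ∑ b, pointMix b₀ r P b *
      (Real.logb 2 (pointMix b₀ r P b) - Real.logb 2 (pointMix b₀ r (1 / 2) b)) = gRE P := by
  have hhalf : Real.logb 2 (1 / 2) = -1 := by
    rw [one_div, Real.logb_inv, Real.logb_self_eq_one one_lt_two]
  rw [sum_eq_of_off_point hr hr0 (y := (1 - P) * (Real.logb 2 (1 - P) + 1)) fun b hb => ?_]
  · rw [pointMix_self hr0, pointMix_self hr0, hhalf, gRE]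
    ring
  · rw [pointMix_of_ne hb, pointMix_of_ne hb, sub_half]
    rcases eq_or_ne (r b) 0 with hb0 | hb0
    · simp [hb0]
    rcases eq_or_ne (1 - P) 0 with hP | hP
    · simp [hP]
    rw [Real.logb_mul hP hb0, Real.logb_mul one_half_pos.ne' hb0, hhalf]
    ring

end PointMixSums

/-! ### The functions of the largest eigenvalue -/

lemma gRE_eq_one_sub_binEntropy_div (p : ℝ) : gRE p = 1 - Real.binEntropy p / Real.log 2 := by
  rw [gRE, Real.binEntropy_eq_negMulLog_add_negMulLog_one_sub, Real.negMulLog, Real.negMulLog,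
    Real.logb, Real.logb]
  ring

lemma strictMonoOn_gRE : StrictMonoOn gRE (Set.Icc (1 / 2) 1) := by
  intro p hp p' hp' h
  rw [one_div] at hp hp'
  rw [gRE_eq_one_sub_binEntropy_div, gRE_eq_one_sub_binEntropy_div]
  have := Real.log_pos one_lt_two
  have := Real.binEntropy_strictAntiOn hp hp' h
  gcongr

lemma strictMonoOn_gTr : StrictMonoOn gTr (Set.Icc (1 / 2) 1) :=
  fun _ _ _ _ h => sub_lt_sub_right h _

lemma strictMonoOn_gF : StrictMonoOn gF (Set.Icc (1 / 2) 1) := by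
  intro p hp p' hp' h
  refine sub_lt_sub_left (Real.sqrt_lt_sqrt ?_ ?_) _
  · exact mul_nonneg (by linarith [hp'.1]) (sub_nonneg.2 hp'.2)
  · nlinarith [hp.1]

lemma sq_sqrt_one_sub_add_sqrt {p : ℝ} (h0 : 0 ≤ p) (h1 : p ≤ 1) :
    (√(1 - p) + √p) ^ 2 = 1 + 2 * √(p * (1 - p)) := by
  rw [Real.sqrt_mul h0, add_sq, Real.sq_sqrt h0, Real.sq_sqrt (sub_nonneg.2 h1)]
  ring

lemma sq_sqrt_two_div_two_mul {p : ℝ} (h0 : 0 ≤ p) (h1 : p ≤ 1) :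
    (√2 / 2 * (√(1 - p) + √p)) ^ 2 = 1 - gF p := by
  rw [mul_pow, sq_sqrt_one_sub_add_sqrt h0 h1, div_pow, Real.sq_sqrt zero_le_two, gF]
  ring

lemma two_mul_one_sub_sqrt_two_div_two_mul (p : ℝ) :
    2 * (1 - √2 / 2 * (√(1 - p) + √p)) = gB p := by
  rw [gB]
  ring

lemma strictMonoOn_gB : StrictMonoOn gB (Set.Icc (1 / 2) 1) := by
  intro p hp p' hp' h
  have hsum : √2 / 2 * (√(1 - p') + √p') < √2 / 2 * (√(1 - p) + √p) := by
    refine lt_of_pow_lt_pow_left₀ 2 (by positivity) ?_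
    rw [sq_sqrt_two_div_two_mul (by linarith [hp.1]) hp.2,
      sq_sqrt_two_div_two_mul (by linarith [hp'.1]) hp'.2]
    exact sub_lt_sub_left (strictMonoOn_gF hp hp' h) 1
  rw [← two_mul_one_sub_sqrt_two_div_two_mul, ← two_mul_one_sub_sqrt_two_div_two_mul]
  linarith

lemma gRE_half : gRE (1 / 2) = 0 := by
  rw [gRE_eq_one_sub_binEntropy_div, one_div, Real.binEntropy_two_inv,
    div_self (Real.log_pos one_lt_two).ne', sub_self]

lemma gTr_half : gTr (1 / 2) = 0 :=
  sub_self _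

lemma gF_half : gF (1 / 2) = 0 := by
  rw [gF, sub_half, Real.sqrt_mul_self one_half_pos.le, sub_self]

lemma gB_half : gB (1 / 2) = 0 := by
  rw [gB, sub_half, ← two_mul, mul_left_comm, ← Real.sqrt_mul zero_le_two]
  norm_num

/-! ### The laws of the standard distances -/

section SelfDistance

variable {n : Type*} [Fintype n] [DecidableEq n] {ρ : Matrix n n ℂ}

lemma dRE_self (ρ : Matrix n n ℂ) : dRE ρ ρ = 0 := by
  rw [dRE, if_pos fun v hv => hv, sub_self, mul_zero, trace_zero, Complex.zero_re,
    ENNReal.ofReal_zero]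

lemma dTr_self (ρ : Matrix n n ℂ) : dTr ρ ρ = 0 := by
  simp [dTr]

lemma rootFidelity_self (hρ : ρ.PosSemidef) : rootFidelity ρ ρ = ρ.trace.re := by
  have hsq : cfc Real.sqrt ρ * ρ * cfc Real.sqrt ρ = cfc (fun x : ℝ => x * x) ρ := by
    nth_rw 2 [← cfc_id' ℝ ρ hρ.1.isSelfAdjoint]
    rw [cfc_mul_cfc, cfc_mul_cfc]
    refine cfc_congr_of_posSemidef hρ fun x hx => ?_
    rw [mul_right_comm, Real.mul_self_sqrt hx]
  rw [rootFidelity, hsq, ← cfc_comp' Real.sqrt (fun x : ℝ => x * x) ρ (ha := hρ.1.isSelfAdjoint),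
    cfc_congr_of_posSemidef hρ fun (x : ℝ) hx => Real.sqrt_mul_self hx,
    cfc_id' ℝ ρ hρ.1.isSelfAdjoint]

lemma dF_self (hρ : IsState ρ) : dF ρ ρ = 0 := by
  simp [dF, rootFidelity_self hρ.1, hρ.2]

lemma dB_self (hρ : IsState ρ) : dB ρ ρ = 0 := by
  simp [dB, rootFidelity_self hρ.1, hρ.2]

lemma dH_self (hρ : IsState ρ) : dH ρ ρ = 0 := by
  simp [dH, cfc_sqrt_mul_self hρ.1, hρ.2]

end SelfDistance

section Laws

variable {N : ℕ}

theorem SharpOverlapBound.genuineLaw_ofReal {D : QOp N → QOp N → ℝ≥0∞} {g : ℝ → ℝ}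
    (h : SharpOverlapBound N D fun p => ENNReal.ofReal (g p)) (hN : 2 ≤ N)
    (hg : StrictMonoOn g (Set.Icc (1 / 2) 1)) (hg0 : g (1 / 2) = 0) :
    GenuineLaw N D fun p => ENNReal.ofReal (g p) := by
  refine h.genuineLaw hN (fun p hp p' hp' hle => ?_) fun _ p p' hp hlt hp' _ => ?_
  · exact ENNReal.ofReal_le_ofReal
      (hg.monotoneOn (Set.Ioc_subset_Icc_self hp) (Set.Ioc_subset_Icc_self hp') hle)
  · have hp'mem : p' ∈ Set.Icc (1 / 2 : ℝ) 1 := ⟨(hp.trans hlt).le, hp'⟩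
    have hpos : 0 < g p' :=
      hg0.symm.trans_lt (hg ⟨le_rfl, one_half_lt_one.le⟩ hp'mem (hp.trans hlt))
    exact (ENNReal.ofReal_lt_ofReal_iff hpos).2 (hg ⟨hp.le, hlt.le.trans hp'⟩ hp'mem hlt)

lemma dRE_ghzDiag_pointMix [NeZero N] {b₀ : Index N} {r : Index N → ℝ}
    (hr : r ∈ stdSimplex ℝ (Index N)) (hr0 : r b₀ = 0) (P : ℝ) :
    dRE (ghzDiag (pointMix b₀ r P)) (ghzDiag (pointMix b₀ r (1 / 2))) =
      ENNReal.ofReal (gRE P) := by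
  rw [dRE, if_pos fun v => ghzDiag_mulVec_eq_zero fun b => pointMix_eq_zero_of_half hr0 P,
    relativeEntropy_ghzDiag, sum_mul_logb_sub_logb_pointMix_half hr hr0]

theorem genuineLaw_dRE (hN : 2 ≤ N) : GenuineLaw N dRE fun p => ENNReal.ofReal (gRE p) := by
  have : NeZero N := ⟨by omega⟩
  refine SharpOverlapBound.genuineLaw_ofReal ⟨fun ρ _ => dRE_self ρ,
    fun ψ hψ ρ σ hρ hσ hP hq => ?_, fun b₀ r hr hr0 P _ _ => dRE_ghzDiag_pointMix hr hr0 P⟩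
    hN strictMonoOn_gRE gRE_half
  rw [dRE]
  split_ifs with hker
  · exact ENNReal.ofReal_le_ofReal (gRE_le_relativeEntropy hψ hρ hσ hP.le hq hker)
  · exact le_top

lemma dTr_ghzDiag_pointMix [NeZero N] {b₀ : Index N} {r : Index N → ℝ}
    (hr : r ∈ stdSimplex ℝ (Index N)) (hr0 : r b₀ = 0) {P : ℝ} (hP : 1 / 2 ≤ P) :
    dTr (ghzDiag (pointMix b₀ r P)) (ghzDiag (pointMix b₀ r (1 / 2))) =
      ENNReal.ofReal (gTr P) := by
  rw [dTr, trace_abs_ghzDiag_sub, sum_abs_pointMix_sub hr hr0, abs_of_nonneg (sub_nonneg.2 hP),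
    ← mul_assoc, one_div_mul_cancel two_ne_zero, one_mul, gTr]

theorem genuineLaw_dTr (hN : 2 ≤ N) : GenuineLaw N dTr fun p => ENNReal.ofReal (gTr p) := by
  have : NeZero N := ⟨by omega⟩
  refine SharpOverlapBound.genuineLaw_ofReal ⟨fun ρ _ => dTr_self ρ,
    fun ψ hψ ρ σ hρ hσ _ hq => ?_, fun b₀ r hr hr0 P hP _ => dTr_ghzDiag_pointMix hr hr0 hP.le⟩
    hN strictMonoOn_gTr gTr_half
  exact ENNReal.ofReal_le_ofReal
    ((sub_le_sub_left hq _).trans (expVal_sub_le_trace_abs hψ hρ hσ))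

lemma rootFidelity_ghzDiag_pointMix [NeZero N] {b₀ : Index N} {r : Index N → ℝ}
    (hr : r ∈ stdSimplex ℝ (Index N)) (hr0 : r b₀ = 0) {P : ℝ} (hP : P ≤ 1) :
    rootFidelity (ghzDiag (pointMix b₀ r P)) (ghzDiag (pointMix b₀ r (1 / 2))) =
      √2 / 2 * (√(1 - P) + √P) := by
  have hmem := pointMix_mem_stdSimplex b₀ hr one_half_pos.le one_half_lt_one.le
  rw [rootFidelity_ghzDiag _ hmem.1, sum_sqrt_mul_sqrt_pointMix_half hr hr0 hP]

theorem genuineLaw_dF (hN : 2 ≤ N) : GenuineLaw N dF fun p => ENNReal.ofReal (gF p) := by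
  have : NeZero N := ⟨by omega⟩
  refine SharpOverlapBound.genuineLaw_ofReal ⟨fun ρ => dF_self,
    fun ψ hψ ρ σ hρ hσ hP hq => ?_, fun b₀ r hr hr0 P hP hP1 => ?_⟩ hN strictMonoOn_gF gF_half
  · have hle := pow_le_pow_left₀ (rootFidelity_nonneg ρ σ) (rootFidelity_le hψ hρ hσ hP.le hq) 2
    rw [sq_sqrt_two_div_two_mul (one_half_pos.trans hP).le (expVal_le_one hψ hρ)] at hle
    exact ENNReal.ofReal_le_ofReal (le_sub_comm.1 hle)
  · rw [dF, rootFidelity_ghzDiag_pointMix hr hr0 hP1,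
      sq_sqrt_two_div_two_mul (one_half_pos.trans hP).le hP1, sub_sub_cancel]

theorem genuineLaw_dB (hN : 2 ≤ N) : GenuineLaw N dB fun p => ENNReal.ofReal (gB p) := by
  have : NeZero N := ⟨by omega⟩
  refine SharpOverlapBound.genuineLaw_ofReal ⟨fun ρ => dB_self,
    fun ψ hψ ρ σ hρ hσ hP hq => ?_, fun b₀ r hr hr0 P _ hP1 => ?_⟩ hN strictMonoOn_gB gB_half
  · rw [dB, ← two_mul_one_sub_sqrt_two_div_two_mul]
    gcongr
    exact rootFidelity_le hψ hρ hσ hP.le hq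
  · rw [dB, rootFidelity_ghzDiag_pointMix hr hr0 hP1, two_mul_one_sub_sqrt_two_div_two_mul]

theorem genuineLaw_dH (hN : 2 ≤ N) : GenuineLaw N dH fun p => ENNReal.ofReal (gB p) := by
  have : NeZero N := ⟨by omega⟩
  refine SharpOverlapBound.genuineLaw_ofReal ⟨fun ρ => dH_self,
    fun ψ hψ ρ σ hρ hσ hP hq => ?_, fun b₀ r hr hr0 P _ hP1 => ?_⟩ hN strictMonoOn_gB gB_half
  · rw [dH, ← two_mul_one_sub_sqrt_two_div_two_mul]
    gcongr
    exact affinity_le hψ hρ hσ hP.le hq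
  · rw [dH, affinity_ghzDiag, sum_sqrt_mul_sqrt_pointMix_half hr hr0 hP1,
      two_mul_one_sub_sqrt_two_div_two_mul]

end Laws

end GHZ

end

theorem mainTheorem8 :
    -- GHZ-diagonal states are biseparable exactly when the largest eigenvalue is at most 1/2
    (∀ N : ℕ, 2 ≤ N → ∀ p ∈ stdSimplex ℝ (GHZ.Index N), ∀ b₀, (∀ b, p b ≤ p b₀) →
      (GHZ.ghzDiag p ∈ GHZ.mSeparable N 2 ↔ p b₀ ≤ 1 / 2)) ∧
    -- GHZ-diagonalisation is a fixed mixture of local unitaries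
    (∀ N : ℕ, 2 ≤ N → ∃ (K : ℕ) (w : Fin K → ℝ) (U : Fin K → Fin N → Matrix (Fin 2) (Fin 2) ℂ),
      w ∈ stdSimplex ℝ (Fin K) ∧ (∀ j k, U j k ∈ Matrix.unitaryGroup (Fin 2) ℂ) ∧
      ∀ ρ : GHZ.QOp N, GHZ.IsState ρ →
        GHZ.overlap ρ ∈ stdSimplex ℝ (GHZ.Index N) ∧
        ∑ j, w j • GHZ.localConj (U j) ρ = GHZ.ghzDiag (GHZ.overlap ρ)) ∧
    -- every contractive convex distance on N-qubit states
    (∀ N : ℕ, 2 ≤ N → ∀ D : GHZ.QOp N → GHZ.QOp N → ENNReal, GHZ.IsContractiveConvex D →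
      ∃ g : ℝ → ENNReal, GHZ.GenuineLaw N D g) ∧
    -- the function g does not depend on N for a distance that is given for all N
    (∀ D : (N : ℕ) → GHZ.QOp N → GHZ.QOp N → ENNReal, GHZ.IsContractiveConvexFamily D →
      ∃ g : ℝ → ENNReal, ∀ N : ℕ, 2 ≤ N → GHZ.GenuineLaw N (D N) g) ∧
    -- the standard distances
    (∀ N : ℕ, 2 ≤ N →
      GHZ.GenuineLaw N GHZ.dRE (fun p => ENNReal.ofReal (GHZ.gRE p)) ∧
      GHZ.GenuineLaw N GHZ.dTr (fun p => ENNReal.ofReal (GHZ.gTr p)) ∧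
      GHZ.GenuineLaw N GHZ.dF (fun p => ENNReal.ofReal (GHZ.gF p)) ∧
      GHZ.GenuineLaw N GHZ.dB (fun p => ENNReal.ofReal (GHZ.gB p)) ∧
      GHZ.GenuineLaw N GHZ.dH (fun p => ENNReal.ofReal (GHZ.gB p))) ∧
    (StrictMonoOn GHZ.gRE (Set.Icc (1 / 2) 1) ∧ StrictMonoOn GHZ.gTr (Set.Icc (1 / 2) 1) ∧
      StrictMonoOn GHZ.gF (Set.Icc (1 / 2) 1) ∧ StrictMonoOn GHZ.gB (Set.Icc (1 / 2) 1)) :=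
  ⟨fun _ hN _ hp _ hb => GHZ.ghzDiag_mem_mSeparable_iff hN hp hb,
    fun _ hN => GHZ.exists_ghzDiagonalisation hN,
    fun _ hN _ hD => GHZ.exists_genuineLaw hN hD,
    fun _ hD => GHZ.exists_genuineLaw_family hD,
    fun _ hN => ⟨GHZ.genuineLaw_dRE hN, GHZ.genuineLaw_dTr hN, GHZ.genuineLaw_dF hN,
      GHZ.genuineLaw_dB hN, GHZ.genuineLaw_dH hN⟩,
    GHZ.strictMonoOn_gRE, GHZ.strictMonoOn_gTr, GHZ.strictMonoOn_gF, GHZ.strictMonoOn_gB⟩
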